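/- Fix $\beta>0$. Let $\mu$ be a deterministic probability measure on $\mathbb{C}$ with at least polynomially decaying tail, i.e. there exists $c>0$ with $$\sup_{R\ge 1} R^c\,\mu(\{z\in\mathbb{C} : |z|>R\})<\infty,$$ and let $(m(n))_{n\ge 2}$ be integers with $1\le m(n)\le n-1$ and $$\frac{m(n)}{n/\log n}\underset{n\to\infty}{\longrightarrow}0.$$ On one probability space, let for each $n\ge 2$ the points $(Z^{(n,0)}_k)_{1\le k\le n}$ be i.i.d. complex random variables with distribution $\mu$, and let $(\gamma^{(n,j)}_k)_{1\le j\le m(n),\,1\le k\le n}$ be i.i.d. Gamma random variables of parameter $\beta/2$ (density $\Gamma(\beta/2)^{-1}t^{\beta/2-1}e^{-t}$ on $(0,\infty)$), independent of $(Z^{(n,0)}_k)_{1\le k\le n}$; nothing is assumed on the joint law for different $n$. For $1\le j\le m(n)$, define inductively $(Z^{(n,j)}_k)_{1\le k\le n}$ as the zeros, counted with multiplicity, of the polynomial $$z\mapsto\sum_{k=1}^n\gamma^{(n,j)}_k\,\bigl(Z^{(n,j-1)}_k+z\bigr)\prod_{1\le\ell\le n,\ \ell\ne k}\bigl(z-Z^{(n,j-1)}_\ell\bigr),$$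 which almost surely has degree $n$; the zeros are labelled in any measurable way depending only on $(Z^{(n,0)}_k)_k$ and on $(\gamma^{(n,i)}_k)_{k}$, $1\le i\le j$. Let $$\tilde\mu_{n,m(n)}:=\frac1n\sum_{k=1}^n\delta_{Z^{(n,m(n))}_k}.$$ Then, almost surely, $\tilde\mu_{n,m(n)}$ converges weakly to $\mu$ as $n\to\infty$. -/

import Mathlib

open MeasureTheory ProbabilityTheory Filter Topology
open scoped Polynomial NNReal

/-- The circular randomized derivative with weights `g` of the monic polynomial with zeros `z`:
`∑ₖ gₖ (X + zₖ) ∏_{l ≠ k} (X - zₗ)`. -/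
noncomputable def circularDerivative {n : ℕ} (g : Fin n → ℝ) (z : Fin n → ℂ) : ℂ[X] :=
  ∑ k, Polynomial.C (g k : ℂ) * (Polynomial.X + Polynomial.C (z k)) *
    ∏ l ∈ Finset.univ.erase k, (Polynomial.X - Polynomial.C (z l))

/-- The empirical measure `(1/n) ∑ₖ δ_{zₖ}` of `n` points, as a finite measure, so that convergence
in `FiniteMeasure ℂ` is weak convergence. (It is the zero measure for `n = 0`.) -/
noncomputable def empiricalMeasure {n : ℕ} (z : Fin n → ℂ) : FiniteMeasure ℂ :=
  (n : ℝ≥0)⁻¹ • ∑ k, (diracProba (z k)).toFiniteMeasure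

/-- The information available after `j` iterations: the σ-algebra generated by the initial points
`Z₀` and by the weights of the first `j` iterations (`γ i` is the row of weights of iteration
`i + 1`). -/
@[reducible] noncomputable def circularPast {Ω : Type*} {n m : ℕ} (Z₀ : Fin n → Ω → ℂ) (γ : Fin m → Fin n → Ω → ℝ) (j : ℕ) :
    MeasurableSpace Ω :=
  (⨆ k, MeasurableSpace.comap (Z₀ k) inferInstance) ⊔
    ⨆ (i : Fin m) (_ : i.val < j) (k : Fin n), MeasurableSpace.comap (γ i k) inferInstance

/-- `Z 0, …, Z m` are the successive families of `n` points obtained from the initial points `Z 0`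
by iterating the circular randomized derivative with the weights `γ 0, …, γ (m - 1)`: almost surely
the points `Z (j + 1)` are the zeros, with multiplicity, of the circular derivative of the points
`Z j`. The zeros may be labelled in any measurable way that does not use the weights of later
iterations. -/
structure IsCircularIteration {Ω : Type*} [MeasurableSpace Ω] (P : Measure Ω) {n m : ℕ}
    (γ : Fin m → Fin n → Ω → ℝ) (Z : Fin (m + 1) → Fin n → Ω → ℂ) : Prop where
  zeros : ∀ j : Fin m, ∀ᵐ ω ∂P,
    Finset.univ.val.map (fun k => Z j.succ k ω) =
      (circularDerivative (fun k => γ j k ω) (fun k => Z j.castSucc k ω)).roots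
  labelling : ∀ (j : Fin (m + 1)) (k : Fin n), Measurable[circularPast (Z 0) γ j.val] (Z j k)

/-! The proof compares logarithmic potentials. If `w` are the zeros of the circular derivative of
`z` with weights `g`, then `(∑ g) ∏ (x - w k) = S(x) ∏ (x - z k)` with `S(x) = ∑ g k (x + z k) / (x
- z k)`. So one iteration changes `∑ log ‖x - z k‖` by `log ‖S(x)‖ - log ∑ g`, which is `O(log n)`
unless `S(x)` is polynomially large or small. It is not large when `x` stays away from the `z k`
(`angleMeasure_norm_circleMap_sub_le`). It is not small because `S(x)` is affine in each weight, and
that weight, independent of all other data, rarely falls near the one critical value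
(`indepFun_criticalWeight`, `exists_gammaMeasure_Icc_le`). After `m n` iterations the normalised
potential has moved by `O(m n * log n / n)`, which tends to 0 (`abs_sum_log_last_sub_log_zero_le`).

This control fails on a set of (outcome, angle) pairs of measure `O(n ^ (-2))`. That is summable, so
almost surely the exceptional angles on a fixed circle have measure tending to 0. The potentials
minus their circle means are bounded in `L²` uniformly in the points, so the circle means of the
final and initial potentials also agree in the limit (`tendsto_average_circleLog_sub`).

The mean of `log ‖z - w‖` over a circle is `log (max R ‖c - w‖)`. The difference of two concentric
means is a compactly supported bump, and countably many such bumps determine weak convergence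
(`tendsto_of_tendsto_integral_logBump`). For the initial points, bump averages converge by
Hoeffding's inequality and Borel–Cantelli (`ae_tendsto_average`). -/

/-! ### Logarithmic bumps and weak convergence -/

/-- The average of `z ↦ log ‖z - w‖` over the circle of centre `c` and radius `R > 0`. -/
noncomputable def circleLog (c : ℂ) (R : ℝ) (w : ℂ) : ℝ :=
  Real.log R + Real.posLog (R⁻¹ * ‖c - w‖)

/-- A continuous function equal to `log (R / r)` on the ball of radius `r` around `c` and vanishing
outside the ball of radius `R`. -/
noncomputable def logBump (c : ℂ) (r R : ℝ) (w : ℂ) : ℝ :=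
  circleLog c R w - circleLog c r w

lemma continuous_circleLog (c : ℂ) (R : ℝ) : Continuous (circleLog c R) := by
  unfold circleLog
  exact continuous_const.add (Real.continuous_posLog.comp (by fun_prop))

lemma continuous_logBump (c : ℂ) (r R : ℝ) : Continuous (logBump c r R) :=
  (continuous_circleLog c R).sub (continuous_circleLog c r)

/-- Since `Real.log 0 = 0`, the formula fails at `w = c` when `R < 1`; `circleLog_eq_log_max` has no
such restriction. -/
lemma circleLog_eq_max {c : ℂ} {R : ℝ} (hR : 0 < R) {w : ℂ} (hw : 0 < ‖c - w‖) :
    circleLog c R w = max (Real.log R) (Real.log ‖c - w‖) := by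
  unfold circleLog
  change Real.log R + max 0 (Real.log (R⁻¹ * ‖c - w‖)) = _
  rw [Real.log_mul (by positivity) hw.ne', Real.log_inv, ← max_add_add_left]
  congr 1 <;> ring

lemma circleLog_of_le {c : ℂ} {R : ℝ} (hR : 0 < R) {w : ℂ} (hw : ‖c - w‖ ≤ R) :
    circleLog c R w = Real.log R := by
  unfold circleLog
  rw [Real.posLog_eq_zero_iff _ |>.2, add_zero]
  rw [abs_of_nonneg (by positivity), inv_mul_le_iff₀ hR]
  simpa using hw

lemma logBump_of_le {c : ℂ} {r R : ℝ} (hr : 0 < r) (hrR : r < R) {w : ℂ} (hw : ‖c - w‖ ≤ r) :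
    logBump c r R w = Real.log R - Real.log r := by
  rw [logBump, circleLog_of_le (hr.trans hrR) (hw.trans hrR.le), circleLog_of_le hr hw]

lemma logBump_of_ge {c : ℂ} {r R : ℝ} (hr : 0 < r) (hrR : r < R) {w : ℂ} (hw : R ≤ ‖c - w‖) :
    logBump c r R w = 0 := by
  have hR := hr.trans hrR
  have h0 : 0 < ‖c - w‖ := hR.trans_le hw
  rw [logBump, circleLog_eq_max hR h0, circleLog_eq_max hr h0,
    max_eq_right (Real.log_le_log hR hw), max_eq_right (Real.log_le_log hr (hrR.le.trans hw)),
    sub_self]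

lemma logBump_mem_Icc {c : ℂ} {r R : ℝ} (hr : 0 < r) (hrR : r < R) (w : ℂ) :
    logBump c r R w ∈ Set.Icc 0 (Real.log R - Real.log r) := by
  have hR := hr.trans hrR
  have hlog := Real.log_le_log hr hrR.le
  rcases le_or_gt ‖c - w‖ r with h | h
  · rw [logBump_of_le hr hrR h]
    exact ⟨by linarith, le_rfl⟩
  · have h0 : 0 < ‖c - w‖ := hr.trans h
    rw [logBump, circleLog_eq_max hR h0, circleLog_eq_max hr h0,
      max_eq_right (Real.log_le_log hr h.le)]
    have := Real.log_le_log hr h.le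
    constructor
    · linarith [le_max_right (Real.log R) (Real.log ‖c - w‖)]
    · rcases max_cases (Real.log R) (Real.log ‖c - w‖) with ⟨h, _⟩ | ⟨h, _⟩ <;> rw [h] <;> linarith

lemma integrable_logBump {c : ℂ} {r R : ℝ} (hr : 0 < r) (hrR : r < R) (μ : Measure ℂ)
    [IsFiniteMeasure μ] : Integrable (logBump c r R) μ :=
  Integrable.of_mem_Icc _ _ (continuous_logBump c r R).measurable.aemeasurable
    (ae_of_all _ (logBump_mem_Icc hr hrR))

/-- A normalised logarithmic bump with dense centre and rational radii fits between the indicator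
functions of two concentric balls. -/
lemma exists_logBump_between (x : ℂ) {ρ δ : ℝ} (hρ : 0 < ρ) (hδ : 0 < δ) :
    ∃ (i : ℕ) (r R : ℚ), 0 < r ∧ r < R ∧
      (∀ w ∈ Metric.closedBall x ρ, (Real.log R - Real.log r)⁻¹ *
        logBump (TopologicalSpace.denseSeq ℂ i) r R w = 1) ∧
      (∀ w ∉ Metric.ball x (ρ + δ), (Real.log R - Real.log r)⁻¹ *
        logBump (TopologicalSpace.denseSeq ℂ i) r R w = 0) ∧
      ∀ w, (Real.log R - Real.log r)⁻¹ *
        logBump (TopologicalSpace.denseSeq ℂ i) r R w ∈ Set.Icc 0 1 := by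
  obtain ⟨i, hi⟩ := (TopologicalSpace.denseRange_denseSeq ℂ).exists_dist_lt x
    (show 0 < δ / 4 by positivity)
  obtain ⟨r, hr1, hr2⟩ := exists_rat_btwn (show ρ + δ / 4 < ρ + δ / 2 by linarith)
  obtain ⟨R, hR1, hR2⟩ := exists_rat_btwn (show ρ + δ / 2 < ρ + 3 * δ / 4 by linarith)
  have hr0 : (0 : ℝ) < r := by linarith
  have hrR : (r : ℝ) < R := hr2.trans hR1
  have hlog : 0 < Real.log R - Real.log r := sub_pos.2 (Real.log_lt_log hr0 hrR)
  have hdist : ∀ w, ‖TopologicalSpace.denseSeq ℂ i - w‖ = dist w (TopologicalSpace.denseSeq ℂ i) :=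
    fun w => by rw [dist_comm, dist_eq_norm]
  refine ⟨i, r, R, by exact_mod_cast hr0, by exact_mod_cast hrR, fun w hw => ?_, fun w hw => ?_,
    fun w => ?_⟩
  · rw [logBump_of_le hr0 hrR, inv_mul_cancel₀ hlog.ne']
    rw [hdist]
    rw [Metric.mem_closedBall] at hw
    linarith [dist_triangle w x (TopologicalSpace.denseSeq ℂ i)]
  · rw [logBump_of_ge hr0 hrR, mul_zero]
    rw [hdist]
    rw [Metric.mem_ball, not_lt] at hw
    linarith [dist_triangle w (TopologicalSpace.denseSeq ℂ i) x,
      dist_comm x (TopologicalSpace.denseSeq ℂ i)]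
  · have := logBump_mem_Icc (c := TopologicalSpace.denseSeq ℂ i) hr0 hrR w
    refine ⟨mul_nonneg (by positivity) this.1, ?_⟩
    rw [inv_mul_le_iff₀ hlog, mul_one]
    exact this.2

/-- Besicovitch's theorem exhausts `G` up to a null set by countably many disjoint balls, and a
finite subfamily already exceeds `a`. Balls are needed because the bumps are radial. -/
lemma exists_finset_disjoint_closedBall (μ : Measure ℂ) [IsFiniteMeasure μ] {G : Set ℂ}
    (hG : IsOpen G) {a : ENNReal} (ha : a < μ G) :
    ∃ (s : Finset ℂ) (ρ : ℂ → ℝ), (∀ x ∈ s, 0 < ρ x) ∧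
      (∀ x ∈ s, Metric.closedBall x (ρ x) ⊆ G) ∧
      (s : Set ℂ).PairwiseDisjoint (fun x => Metric.closedBall x (ρ x)) ∧
      a < ∑ x ∈ s, μ (Metric.closedBall x (ρ x)) := by
  obtain ⟨t, ρ, ht, -, hρ, hcov, hdisj⟩ := Besicovitch.exists_disjoint_closedBall_covering_ae μ
    (fun x => {r | Metric.closedBall x r ⊆ G}) G (fun x hx δ hδ => by
      obtain ⟨ε, hε, hεG⟩ := Metric.nhds_basis_closedBall.mem_iff.1 (hG.mem_nhds hx)
      refine ⟨min ε (δ / 2), ?_, lt_min hε (by positivity), ?_⟩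
      · exact (Metric.closedBall_subset_closedBall (min_le_left _ _)).trans hεG
      · exact (min_le_right _ _).trans_lt (by linarith)) (fun _ => 1) (fun _ _ => one_pos)
  have h1 : μ G ≤ ∑' x : t, μ (Metric.closedBall (x : ℂ) (ρ x)) := by
    calc μ G ≤ μ (⋃ x ∈ t, Metric.closedBall x (ρ x)) := by
          rw [← measure_inter_add_sdiff₀ (μ := μ) G (t := ⋃ x ∈ t, Metric.closedBall x (ρ x))
            (MeasurableSet.biUnion ht fun x _ => Metric.isClosed_closedBall.measurableSet).nullMeasurableSet,
            hcov, add_zero]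
          exact measure_mono Set.inter_subset_right
      _ ≤ _ := measure_biUnion_le μ ht _
  rw [ENNReal.tsum_eq_iSup_sum] at h1
  obtain ⟨s, hs⟩ := lt_iSup_iff.1 (ha.trans_le h1)
  refine ⟨s.map (Function.Embedding.subtype _), ρ, ?_, ?_, ?_, ?_⟩
  · intro x hx
    obtain ⟨y, -, rfl⟩ := Finset.mem_map.1 hx
    exact (hρ y y.2).2.1
  · intro x hx
    obtain ⟨y, -, rfl⟩ := Finset.mem_map.1 hx
    exact (hρ y y.2).1
  · refine hdisj.subset ?_
    intro x hx
    obtain ⟨y, -, rfl⟩ := Finset.mem_map.1 (Finset.mem_coe.1 hx)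
    exact y.2
  · simpa using hs

/-- Convergence of the integrals of the logarithmic bumps with dense centres and rational radii
implies weak convergence. -/
theorem tendsto_of_tendsto_integral_logBump {μ : ProbabilityMeasure ℂ}
    {ν : ℕ → ProbabilityMeasure ℂ}
    (h : ∀ (i : ℕ) (r R : ℚ), 0 < r → r < R →
      Tendsto (fun n => ∫ w, logBump (TopologicalSpace.denseSeq ℂ i) r R w ∂(ν n : Measure ℂ)) atTop
        (𝓝 (∫ w, logBump (TopologicalSpace.denseSeq ℂ i) r R w ∂(μ : Measure ℂ)))) :
    Tendsto ν atTop (𝓝 μ) := by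
  -- Portmanteau: it suffices that `μ G` is at most the lower limit of `ν n G` for open `G`.
  refine tendsto_of_forall_isOpen_le_liminf' fun G hG => le_of_forall_lt fun a ha => ?_
  obtain ⟨b, hab, hb⟩ := exists_between ha
  obtain ⟨s, ρ, hρ, hsub, hdisj, hsum⟩ := exists_finset_disjoint_closedBall (μ : Measure ℂ) hG hb
  -- By compactness the balls can be enlarged slightly, staying disjoint and inside `G`; this leaves
  -- room for each bump to fall from 1 to 0.
  obtain ⟨δ, hδ, hδG, hδd⟩ : ∃ δ > 0, (∀ x ∈ s, Metric.ball x (ρ x + δ) ⊆ G) ∧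
      (s : Set ℂ).PairwiseDisjoint (fun x => Metric.ball x (ρ x + δ)) := by
    have e1 : ∀ᶠ δ in 𝓝[>] (0 : ℝ), ∀ x ∈ s, Metric.ball x (ρ x + δ) ⊆ G := by
      rw [eventually_all_finset]
      intro x hx
      obtain ⟨δ, hδ, hδ'⟩ := (isCompact_closedBall x (ρ x)).exists_thickening_subset_open hG (hsub x hx)
      filter_upwards [Ioo_mem_nhdsGT hδ] with η hη
      rw [thickening_closedBall hδ (hρ x hx).le] at hδ'
      exact (Metric.ball_subset_ball (by linarith [hη.2])).trans hδ'
    have e2 : ∀ᶠ δ in 𝓝[>] (0 : ℝ), ∀ x ∈ s, ∀ y ∈ s, x ≠ y →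
        Disjoint (Metric.ball x (ρ x + δ)) (Metric.ball y (ρ y + δ)) := by
      rw [eventually_all_finset]
      intro x hx
      rw [eventually_all_finset]
      intro y hy
      rcases eq_or_ne x y with rfl | hxy
      · simp
      obtain ⟨δ, hδ, hδ'⟩ := (hdisj hx hy hxy).exists_thickenings (isCompact_closedBall x (ρ x))
        Metric.isClosed_closedBall
      filter_upwards [Ioo_mem_nhdsGT hδ] with η hη _
      rw [thickening_closedBall hδ (hρ x hx).le, thickening_closedBall hδ (hρ y hy).le] at hδ'
      exact hδ'.mono (Metric.ball_subset_ball (by linarith [hη.2]))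
        (Metric.ball_subset_ball (by linarith [hη.2]))
    obtain ⟨δ, h1, h2, h3⟩ := (e1.and (e2.and self_mem_nhdsWithin)).exists
    exact ⟨δ, h3, h1, fun x hx y hy hxy => h2 x hx y hy hxy⟩
  choose! i r R hr hrR hone hzero hIcc using fun x hx =>
    exists_logBump_between x (hρ x hx) hδ
  set ψ : ℂ → ℂ → ℝ := fun x w => (Real.log (R x) - Real.log (r x))⁻¹ *
        logBump (TopologicalSpace.denseSeq ℂ (i x)) (r x) (R x) w with hψ
  have hint : ∀ (κ : Measure ℂ) [IsFiniteMeasure κ], ∀ x ∈ s, Integrable (ψ x) κ := fun κ _ x hx =>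
    (integrable_logBump (by exact_mod_cast hr x hx) (by exact_mod_cast hrR x hx) κ).const_mul _
  -- The enlarged balls are disjoint, so at most one bump is nonzero at each point.
  have hle : ∀ w, ∑ x ∈ s, ψ x w ≤ G.indicator 1 w := by
    intro w
    by_cases hw : ∃ x ∈ s, w ∈ Metric.ball x (ρ x + δ)
    · obtain ⟨x, hx, hxw⟩ := hw
      rw [Finset.sum_eq_single_of_mem x hx, Set.indicator_of_mem (hδG x hx hxw)]
      · exact (hIcc x hx w).2
      · intro y hy hyx
        exact hzero y hy w fun hyw => Set.disjoint_left.1 (hδd hy hx hyx) hyw hxw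
    · push Not at hw
      rw [Finset.sum_eq_zero fun x hx => hzero x hx w (hw x hx)]
      exact Set.indicator_nonneg (fun _ _ => zero_le_one) w
  have hlim : Tendsto (fun n => ∑ x ∈ s, ∫ w, ψ x w ∂(ν n : Measure ℂ)) atTop
      (𝓝 (∑ x ∈ s, ∫ w, ψ x w ∂(μ : Measure ℂ))) := by
    refine tendsto_finsetSum _ fun x hx => ?_
    simp only [hψ, integral_const_mul]
    exact (h (i x) (r x) (R x) (hr x hx) (hrR x hx)).const_mul _
  have hb' : b.toReal < ∑ x ∈ s, ∫ w, ψ x w ∂(μ : Measure ℂ) := by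
    have h2 : ∑ x ∈ s, (μ : Measure ℂ) (Metric.closedBall x (ρ x)) =
        ENNReal.ofReal (∑ x ∈ s, (μ : Measure ℂ).real (Metric.closedBall x (ρ x))) := by
      rw [ENNReal.ofReal_sum_of_nonneg fun _ _ => measureReal_nonneg]
      exact Finset.sum_congr rfl fun x _ => (ofReal_measureReal).symm
    rw [h2, ENNReal.lt_ofReal_iff_toReal_lt (hb.trans_le le_top).ne] at hsum
    refine hsum.trans_le (Finset.sum_le_sum fun x hx => ?_)
    rw [← integral_indicator_one Metric.isClosed_closedBall.measurableSet]
    refine integral_mono ((integrable_const (1 : ℝ)).indicator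
      Metric.isClosed_closedBall.measurableSet) (hint _ x hx) fun w => ?_
    by_cases hw : w ∈ Metric.closedBall x (ρ x)
    · rw [Set.indicator_of_mem hw]
      exact (hone x hx w hw).ge
    · rw [Set.indicator_of_notMem hw]
      exact (hIcc x hx w).1
  refine hab.trans_le (le_liminf_of_le (by isBoundedDefault) ?_)
  filter_upwards [hlim.eventually (lt_mem_nhds hb')] with n hn
  have h3 : b.toReal < (ν n : Measure ℂ).real G := by
    refine hn.trans_le ?_
    rw [← integral_finsetSum _ fun x hx => hint _ x hx, ← integral_indicator_one hG.measurableSet]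
    exact integral_mono (integrable_finsetSum _ fun x hx => hint _ x hx)
      ((integrable_const (1 : ℝ)).indicator hG.measurableSet) hle
  exact ((ENNReal.toReal_lt_toReal (hb.trans_le le_top).ne (measure_ne_top _ _)).1 h3).le

/-! ### Logarithmic potentials on a circle -/

/-- If centred functions `F n`, bounded in `L²`, are close to constants `-d n` outside of sets of
small measure, then these constants are close to zero. -/
lemma tendsto_zero_of_integral_sq_le {α : Type*} [MeasurableSpace α] {ν : Measure α}
    [IsFiniteMeasure ν] (hν : ν ≠ 0) {F : ℕ → α → ℝ} {d ε : ℕ → ℝ} {B : ℕ → Set α} {K : ℝ}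
    (hF : ∀ᶠ n in atTop, Integrable (F n) ν) (hF0 : ∀ᶠ n in atTop, ∫ x, F n x ∂ν = 0)
    (hF2 : ∀ᶠ n in atTop, Integrable (fun x => F n x ^ 2) ν)
    (hK : ∀ᶠ n in atTop, ∫ x, F n x ^ 2 ∂ν ≤ K)
    (hB : ∀ᶠ n in atTop, MeasurableSet (B n)) (hBν : Tendsto (fun n => ν.real (B n)) atTop (𝓝 0))
    (hε : Tendsto ε atTop (𝓝 0)) (hFd : ∀ᶠ n in atTop, ∀ x ∉ B n, |F n x + d n| ≤ ε n) :
    Tendsto d atTop (𝓝 0) := by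
  have hν0 : 0 < ν.real Set.univ := by
    rw [measureReal_def, ENNReal.toReal_pos_iff]
    exact ⟨(Measure.measure_univ_pos).2 hν, measure_lt_top _ _⟩
  -- Integrate `F n + d n` off `B n`. As `F n` is centred, its integral there is minus the one over
  -- `B n`, bounded through `|F| ≤ η F² + η⁻¹`; `η` stays free until the end.
  have key : ∀ η : ℝ, 0 < η → ∀ᶠ n in atTop,
      |d n| * (ν.real Set.univ - ν.real (B n)) ≤
        |ε n| * ν.real Set.univ + (η * K + η⁻¹ * ν.real (B n)) := by
    intro η hη
    filter_upwards [hF, hF0, hF2, hK, hB, hFd] with n h1 h2 h3 h4 h5 h6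
    have hc : ∫ x in (B n)ᶜ, (F n x + d n) ∂ν =
        -∫ x in B n, F n x ∂ν + d n * (ν.real Set.univ - ν.real (B n)) := by
      rw [integral_add h1.integrableOn (integrable_const _), setIntegral_const,
        measureReal_compl h5, smul_eq_mul]
      have := integral_add_compl h5 h1
      rw [h2] at this
      linarith [mul_comm (d n) (ν.real Set.univ - ν.real (B n))]
    have hc1 : |∫ x in (B n)ᶜ, (F n x + d n) ∂ν| ≤ |ε n| * ν.real Set.univ := by
      have := norm_setIntegral_le_of_norm_le_const (μ := ν) (s := (B n)ᶜ) (C := |ε n|)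
        (f := fun x => F n x + d n) (measure_lt_top _ _)
        (fun x hx => (h6 x hx).trans (le_abs_self _))
      refine this.trans (mul_le_mul_of_nonneg_left (measureReal_mono (Set.subset_univ _))
        (abs_nonneg _))
    have hc2 : |∫ x in B n, F n x ∂ν| ≤ η * K + η⁻¹ * ν.real (B n) := by
      calc |∫ x in B n, F n x ∂ν| ≤ ∫ x in B n, |F n x| ∂ν := abs_integral_le_integral_abs
        _ ≤ ∫ x in B n, (η * F n x ^ 2 + η⁻¹) ∂ν := by
            refine integral_mono h1.integrableOn.abs
              ((h3.integrableOn.const_mul _).add (integrable_const _)) fun x => ?_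
            change |F n x| ≤ η * F n x ^ 2 + η⁻¹
            have h : 0 ≤ η⁻¹ * ((η * |F n x| - 1) ^ 2 + η * |F n x|) := by positivity
            have h' : η⁻¹ * ((η * |F n x| - 1) ^ 2 + η * |F n x|) =
                η * |F n x| ^ 2 - |F n x| + η⁻¹ := by field_simp; ring
            rw [h', sq_abs] at h
            linarith
        _ = η * ∫ x in B n, F n x ^ 2 ∂ν + η⁻¹ * ν.real (B n) := by
            rw [integral_add (h3.integrableOn.const_mul _) (integrable_const _),
              integral_const_mul, setIntegral_const, smul_eq_mul, mul_comm (ν.real (B n))]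
        _ ≤ _ := by
            gcongr
            exact (setIntegral_le_integral h3 (ae_of_all _ fun x => sq_nonneg _)).trans h4
    have hpos : 0 ≤ ν.real Set.univ - ν.real (B n) :=
      sub_nonneg.2 (measureReal_mono (Set.subset_univ _))
    rw [← abs_of_nonneg hpos, ← abs_mul]
    have : d n * (ν.real Set.univ - ν.real (B n)) =
      ∫ x in (B n)ᶜ, (F n x + d n) ∂ν + ∫ x in B n, F n x ∂ν := by linarith
    rw [this]
    exact (abs_add_le _ _).trans (add_le_add hc1 hc2)
  have hK0 : 0 ≤ K := by
    obtain ⟨n, hn⟩ := hK.exists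
    exact (integral_nonneg fun x => sq_nonneg (F n x)).trans hn
  rw [Metric.tendsto_atTop']
  intro t ht
  set V := ν.real Set.univ
  -- First `η` makes the `K` term small, then large `n` makes `η⁻¹ * ν.real (B n)` small.
  obtain ⟨η, hη, hηK⟩ : ∃ η : ℝ, 0 < η ∧ η * K < t * V / 8 :=
    ⟨t * V / 8 / (K + 1), by positivity, by
      rw [div_mul_eq_mul_div, div_lt_iff₀ (by positivity)]
      have : 0 < t * V / 8 := by positivity
      nlinarith⟩
  have e1 : Tendsto (fun n => |ε n| * V + η⁻¹ * ν.real (B n)) atTop (𝓝 0) := by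
    simpa using (hε.abs.mul_const V).add (hBν.const_mul η⁻¹)
  have e2 := e1.eventually (gt_mem_nhds (show 0 < t * V / 8 by positivity))
  have e3 := hBν.eventually (gt_mem_nhds (show 0 < V / 2 by positivity))
  obtain ⟨N, hN⟩ := eventually_atTop.1 ((key η hη).and (e2.and e3))
  refine ⟨N, fun n hn => ?_⟩
  obtain ⟨h1, h2, h3⟩ := hN n hn.le
  rw [Real.dist_eq, sub_zero]
  have h4 : |d n| * (V / 2) ≤ |d n| * (V - ν.real (B n)) :=
    mul_le_mul_of_nonneg_left (by linarith) (abs_nonneg _)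
  have h5 : |d n| * (V / 2) < t * (V / 2) := by nlinarith [mul_pos ht hν0]
  exact lt_of_mul_lt_mul_right h5 (by positivity)

/-! ### The integrable majorant `|sin| ^ (-1/2)`. -/

/-- Jordan's inequality `sin θ ≥ 2θ/π` reduces a quarter period to `θ ^ (-1/2)`; reflection and
`π`-periodicity give the rest. This function dominates squared logarithms and also serves in
Markov's inequality. -/
lemma intervalIntegrable_abs_sin_rpow (φ a b : ℝ) :
    IntervalIntegrable (fun θ => |Real.sin (θ - φ)| ^ (-(1 / 2) : ℝ)) volume a b := by
  have hper : Function.Periodic (fun θ => |Real.sin θ| ^ (-(1 / 2) : ℝ)) Real.pi := fun θ => by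
    simp [Real.sin_add_pi]
  have hpos : ∀ c : ℝ, 0 ≤ c → c ≤ Real.pi / 2 →
      IntervalIntegrable (fun θ => |Real.sin θ| ^ (-(1 / 2) : ℝ)) volume 0 c := by
    intro c hc0 hc
    refine ((intervalIntegral.intervalIntegrable_rpow' (a := 0) (b := c) (r := -(1 / 2))
      (by norm_num)).const_mul ((2 / Real.pi) ^ (-(1 / 2) : ℝ))).mono_fun
      (Measurable.aestronglyMeasurable (by fun_prop)) ?_
    rw [Set.uIoc_of_le hc0]
    filter_upwards [ae_restrict_mem measurableSet_Ioc] with θ hθ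
    rw [Real.norm_of_nonneg (by positivity), Real.norm_of_nonneg
      (mul_nonneg (by positivity) (Real.rpow_nonneg hθ.1.le _)), ← Real.mul_rpow (by positivity) hθ.1.le]
    refine Real.rpow_le_rpow_of_nonpos (mul_pos (by positivity) hθ.1) ?_ (by norm_num)
    exact (Real.mul_le_sin hθ.1.le (hθ.2.trans hc)).trans (le_abs_self _)
  have h1 := hpos (Real.pi / 2) (by positivity) le_rfl
  have h2 : IntervalIntegrable (fun θ => |Real.sin θ| ^ (-(1 / 2) : ℝ)) volume
      (-(Real.pi / 2)) 0 := by
    have := (IntervalIntegrable.iff_comp_neg (f := fun θ => |Real.sin θ| ^ (-(1 / 2) : ℝ))).1 h1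
    simpa [Real.sin_neg] using this.symm
  have h3 : IntervalIntegrable (fun θ => |Real.sin θ| ^ (-(1 / 2) : ℝ)) volume
      (-(Real.pi / 2)) (-(Real.pi / 2) + Real.pi) := by
    convert h2.trans h1 using 1; ring
  have h4 := hper.intervalIntegrable Real.pi_pos.ne' h3 (a - φ) (b - φ)
  simpa using h4.comp_sub_right φ

lemma integral_abs_sin_rpow (φ : ℝ) :
    ∫ θ in (0 : ℝ)..2 * Real.pi, |Real.sin (θ - φ)| ^ (-(1 / 2) : ℝ) =
      ∫ θ in (0 : ℝ)..2 * Real.pi, |Real.sin θ| ^ (-(1 / 2) : ℝ) := by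
  have hper : Function.Periodic (fun θ => |Real.sin θ| ^ (-(1 / 2) : ℝ)) (2 * Real.pi) := fun θ => by
    simp
  rw [intervalIntegral.integral_comp_sub_right (fun θ => |Real.sin θ| ^ (-(1 / 2) : ℝ))]
  have := hper.intervalIntegral_add_eq (0 - φ) 0
  rw [zero_add] at this
  rw [← this]
  congr 1
  ring

/-- The length of a circle, parametrised by the angle. -/
noncomputable abbrev angleMeasure : Measure ℝ := volume.restrict (Set.Ioc 0 (2 * Real.pi))

/-- The integral of `|sin θ| ^ (-1/2)` over a period. -/
noncomputable def sinConst : ℝ := ∫ θ, |Real.sin θ| ^ (-(1 / 2) : ℝ) ∂angleMeasure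

lemma angleMeasure_ne_zero : angleMeasure ≠ 0 := by
  rw [Ne, Measure.restrict_eq_zero, Real.volume_Ioc, ENNReal.ofReal_eq_zero]
  simp [Real.pi_pos]

lemma integrable_abs_sin_rpow (φ : ℝ) :
    Integrable (fun θ => |Real.sin (θ - φ)| ^ (-(1 / 2) : ℝ)) angleMeasure :=
  (intervalIntegrable_iff_integrableOn_Ioc_of_le (by positivity)).1
    (intervalIntegrable_abs_sin_rpow φ 0 (2 * Real.pi))

lemma integral_abs_sin_rpow_angleMeasure (φ : ℝ) :
    ∫ θ, |Real.sin (θ - φ)| ^ (-(1 / 2) : ℝ) ∂angleMeasure = sinConst := by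
  have := integral_abs_sin_rpow φ
  rwa [intervalIntegral.integral_of_le (by positivity),
    intervalIntegral.integral_of_le (by positivity)] at this

lemma sinConst_nonneg : 0 ≤ sinConst := integral_nonneg fun _ => by positivity

/-- A point of a circle is at least as far from `w` as from the line through the centre and `w`,
and `w` is at least as far from it as from the corresponding diameter. -/
lemma max_mul_abs_sin_le_norm_circleMap_sub (c : ℂ) {R : ℝ} (hR : 0 < R) (w : ℂ) (θ : ℝ) :
    max R ‖c - w‖ * |Real.sin (θ - (w - c).arg)| ≤ ‖circleMap c R θ - w‖ := by
  set v := w - c with hv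
  have h1 : circleMap c R θ - w = circleMap 0 R θ - v := by simp [circleMap, hv]; ring
  have h2 : ‖c - w‖ = ‖v‖ := norm_sub_rev _ _
  rw [h1, h2, max_mul_of_nonneg _ _ (abs_nonneg _)]
  set ρ := ‖v‖
  have hv' : v = ρ * Complex.exp (v.arg * Complex.I) := (Complex.norm_mul_exp_arg_mul_I v).symm
  -- Rotate so that `v`, respectively (in `e'`) the point of the circle, lies on the real axis; the
  -- imaginary part then bounds the norm from below.
  have e : circleMap 0 R θ - v = (R * Complex.exp ((θ - v.arg : ℝ) * Complex.I) - ρ) *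
      Complex.exp (v.arg * Complex.I) := by
    conv_lhs => rw [hv']
    rw [sub_mul, mul_assoc, ← Complex.exp_add, circleMap, zero_add, ← add_mul]
    push_cast
    ring_nf
  have e' : circleMap 0 R θ - v = (R - ρ * Complex.exp ((v.arg - θ : ℝ) * Complex.I)) *
      Complex.exp (θ * Complex.I) := by
    conv_lhs => rw [hv']
    rw [sub_mul, mul_assoc, ← Complex.exp_add, circleMap, zero_add, ← add_mul]
    push_cast
    ring_nf
  refine max_le ?_ ?_
  · rw [e, norm_mul, Complex.norm_exp_ofReal_mul_I, mul_one]
    refine le_trans (le_of_eq ?_) (Complex.abs_im_le_norm _)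
    rw [Complex.sub_im, Complex.im_ofReal_mul, Complex.exp_ofReal_mul_I_im, Complex.ofReal_im,
      sub_zero, abs_mul, abs_of_pos hR]
  · rw [e', norm_mul, Complex.norm_exp_ofReal_mul_I, mul_one]
    refine le_trans (le_of_eq ?_) (Complex.abs_im_le_norm _)
    rw [Complex.sub_im, Complex.im_ofReal_mul, Complex.exp_ofReal_mul_I_im, Complex.ofReal_im,
      zero_sub, abs_neg, abs_mul, abs_of_nonneg (norm_nonneg v), ← neg_sub, Real.sin_neg, abs_neg]

lemma ae_sin_ne_zero (φ : ℝ) : ∀ᵐ θ ∂angleMeasure, Real.sin (θ - φ) ≠ 0 := by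
  refine ae_restrict_of_ae ?_
  have : {θ : ℝ | Real.sin (θ - φ) = 0} ⊆ Set.range (fun n : ℤ => n * Real.pi + φ) := by
    intro θ hθ
    obtain ⟨n, hn⟩ := Real.sin_eq_zero_iff.1 hθ
    exact ⟨n, by simp only [hn]; ring⟩
  have h0 := ((Set.countable_range _).mono this).measure_zero volume
  rw [ae_iff]
  simpa using h0

/-- The measure of the set of angles for which the point of the circle is close to `w`. -/
lemma angleMeasure_norm_circleMap_sub_le (c : ℂ) {R : ℝ} (hR : 0 < R) (w : ℂ) {ε : ℝ}
    (hε : 0 < ε) :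
    angleMeasure {θ | ‖circleMap c R θ - w‖ ≤ ε} ≤
      ENNReal.ofReal (sinConst * (ε / R) ^ (1 / 2 : ℝ)) := by
  have hεR : 0 < ε / R := by positivity
  -- Markov's inequality: being within `ε` of `w` forces `|sin (θ - arg (w - c))| ≤ ε / R`.
  have h1 := mul_meas_ge_le_integral_of_nonneg (ae_of_all _ fun θ => by positivity)
    (integrable_abs_sin_rpow (w - c).arg) ((ε / R) ^ (-(1 / 2) : ℝ))
  rw [integral_abs_sin_rpow_angleMeasure, Real.rpow_neg hεR.le,
    inv_mul_le_iff₀ (by positivity), mul_comm] at h1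
  rw [← ofReal_measureReal]
  refine ENNReal.ofReal_le_ofReal (le_trans ?_ h1)
  refine ENNReal.toReal_mono (measure_ne_top _ _) (measure_mono_ae ?_)
  filter_upwards [ae_sin_ne_zero (w - c).arg] with θ hθ hw
  change ‖circleMap c R θ - w‖ ≤ ε at hw
  change ((ε / R) ^ (1 / 2 : ℝ))⁻¹ ≤ |Real.sin (θ - (w - c).arg)| ^ (-(1 / 2) : ℝ)
  rw [← Real.rpow_neg hεR.le]
  refine Real.rpow_le_rpow_of_nonpos (abs_pos.2 hθ) ?_ (by norm_num)
  rw [le_div_iff₀ hR, mul_comm]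
  refine le_trans ?_ ((max_mul_abs_sin_le_norm_circleMap_sub c hR w θ).trans hw)
  exact mul_le_mul_of_nonneg_right (le_max_left _ _) (abs_nonneg _)

/-- The logarithmic potential of `w` on a circle, centred to have mean zero. -/
noncomputable def centredLog (c : ℂ) (R : ℝ) (w : ℂ) (θ : ℝ) : ℝ :=
  Real.log ‖circleMap c R θ - w‖ - circleLog c R w

lemma integrable_log_circleMap_sub (c : ℂ) (R : ℝ) (w : ℂ) :
    Integrable (fun θ => Real.log ‖circleMap c R θ - w‖) angleMeasure :=
  (intervalIntegrable_iff_integrableOn_Ioc_of_le (by positivity)).1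
    (circleIntegrable_log_norm_sub_const (a := w) (c := c) R)

lemma integrable_centredLog (c : ℂ) (R : ℝ) (w : ℂ) :
    Integrable (centredLog c R w) angleMeasure :=
  (integrable_log_circleMap_sub c R w).sub (integrable_const _)

lemma integral_centredLog (c : ℂ) {R : ℝ} (hR : 0 < R) (w : ℂ) :
    ∫ θ, centredLog c R w θ ∂angleMeasure = 0 := by
  have h := circleAverage_log_norm_sub_const_eq_log_radius_add_posLog (c := c) (a := w) hR.ne'
  rw [Real.circleAverage, intervalIntegral.integral_of_le (by positivity), smul_eq_mul,
    inv_mul_eq_iff_eq_mul₀ (by positivity)] at h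
  unfold centredLog
  rw [integral_sub (integrable_log_circleMap_sub c R w) (integrable_const _), h, integral_const,
    measureReal_restrict_apply_univ, Real.volume_real_Ioc_of_le (by positivity), circleLog]
  simp

/-- This squares `|log t| * t ^ (1/4) < 4`; the quarter power is chosen so that its square matches
the majorant. -/
lemma sq_log_le {t : ℝ} (h0 : 0 < t) (h1 : t ≤ 1) : Real.log t ^ 2 ≤ 16 * t ^ (-(1 / 2) : ℝ) := by
  have h := Real.abs_log_mul_self_rpow_lt t (1 / 4) h0 h1 (by norm_num)
  have h2 : (Real.log t * t ^ (1 / 4 : ℝ)) ^ 2 ≤ 16 := by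
    rw [show (1 : ℝ) / (1 / 4) = 4 by norm_num] at h
    rw [← sq_abs, show (16 : ℝ) = 4 ^ 2 by norm_num]
    exact pow_le_pow_left₀ (abs_nonneg _) h.le 2
  have h3 : (t ^ (1 / 4 : ℝ)) ^ 2 = t ^ (1 / 2 : ℝ) := by
    rw [← Real.rpow_natCast, ← Real.rpow_mul h0.le]
    norm_num
  rw [mul_pow, h3] at h2
  rw [Real.rpow_neg h0.le, ← div_eq_mul_inv, le_div_iff₀ (by positivity)]
  exact h2

lemma circleLog_eq_log_max {c : ℂ} {R : ℝ} (hR : 0 < R) (w : ℂ) :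
    circleLog c R w = Real.log (max R ‖c - w‖) := by
  rcases le_total ‖c - w‖ R with h | h
  · rw [circleLog_of_le hR h, max_eq_left h]
  · rw [circleLog_eq_max hR (hR.trans_le h), max_eq_right h, max_eq_right (Real.log_le_log hR h)]

/-- With `M = max R ‖c - w‖` the distance lies between `M |sin|` and `2M`, while `circleLog` is `log
M`. So the centred logarithm lies between `log |sin|` and `log 2 < 1`, uniformly in `w`, even for
distant `w`. -/
lemma ae_centredLog_sq_le (c : ℂ) {R : ℝ} (hR : 0 < R) (w : ℂ) :
    ∀ᵐ θ ∂angleMeasure, centredLog c R w θ ^ 2 ≤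
      1 + 16 * |Real.sin (θ - (w - c).arg)| ^ (-(1 / 2) : ℝ) := by
  filter_upwards [ae_sin_ne_zero (w - c).arg] with θ hθ
  have hs := abs_pos.2 hθ
  set s := |Real.sin (θ - (w - c).arg)|
  set M := max R ‖c - w‖ with hM
  have hM0 : 0 < M := hR.trans_le (le_max_left _ _)
  have hlow : M * s ≤ ‖circleMap c R θ - w‖ := max_mul_abs_sin_le_norm_circleMap_sub c hR w θ
  have hup : ‖circleMap c R θ - w‖ ≤ M * 2 := by
    have h1 : circleMap c R θ - w = circleMap 0 R θ + (c - w) := by simp [circleMap]; ring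
    rw [h1]
    refine (norm_add_le _ _).trans ?_
    rw [norm_circleMap_zero, abs_of_pos hR]
    linarith [le_max_left R ‖c - w‖, le_max_right R ‖c - w‖]
  have h1 : Real.log s ≤ centredLog c R w θ := by
    rw [centredLog, circleLog_eq_log_max hR, ← hM]
    have := Real.log_le_log (by positivity) hlow
    rw [Real.log_mul hM0.ne' hs.ne'] at this
    linarith
  have h2 : centredLog c R w θ ≤ 1 := by
    rw [centredLog, circleLog_eq_log_max hR, ← hM]
    have := Real.log_le_log (lt_of_lt_of_le (by positivity) hlow) hup
    rw [Real.log_mul hM0.ne' two_ne_zero] at this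
    linarith [Real.log_two_lt_d9]
  have h3 := sq_log_le hs (Real.abs_sin_le_one _)
  have h4 : Real.log s ≤ 0 := Real.log_nonpos hs.le (Real.abs_sin_le_one _)
  rcases le_total 0 (centredLog c R w θ) with h | h
  · nlinarith [Real.rpow_nonneg hs.le (-(1 / 2))]
  · nlinarith

lemma measurable_centredLog (c : ℂ) (R : ℝ) (w : ℂ) : Measurable (centredLog c R w) := by
  unfold centredLog
  have := (continuous_circleMap c R).measurable
  fun_prop

lemma integrable_centredLog_sq (c : ℂ) {R : ℝ} (hR : 0 < R) (w : ℂ) :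
    Integrable (fun θ => centredLog c R w θ ^ 2) angleMeasure := by
  refine Integrable.mono' ((integrable_const 1).add ((integrable_abs_sin_rpow (w - c).arg).const_mul 16))
    ((measurable_centredLog c R w).pow_const 2).aestronglyMeasurable ?_
  filter_upwards [ae_centredLog_sq_le c hR w] with θ hθ
  rw [Real.norm_of_nonneg (sq_nonneg _)]
  exact hθ

/-- A bound for the variance of the logarithmic potentials on circles. -/
noncomputable def logSqConst : ℝ := 2 * Real.pi + 16 * sinConst

lemma integral_centredLog_sq_le (c : ℂ) {R : ℝ} (hR : 0 < R) (w : ℂ) :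
    ∫ θ, centredLog c R w θ ^ 2 ∂angleMeasure ≤ logSqConst := by
  have h := integral_mono_ae (integrable_centredLog_sq c hR w)
    ((integrable_const 1).add ((integrable_abs_sin_rpow (w - c).arg).const_mul 16))
    (ae_centredLog_sq_le c hR w)
  refine h.trans (le_of_eq ?_)
  simp only [Pi.add_apply]
  rw [integral_add (integrable_const _) ((integrable_abs_sin_rpow (w - c).arg).const_mul 16),
    integral_const_mul, integral_abs_sin_rpow_angleMeasure, integral_const,
    measureReal_restrict_apply_univ, Real.volume_real_Ioc_of_le (by positivity), logSqConst]
  simp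

/-- The averages of `circleLog` over two families of points are asymptotically equal if the
logarithmic potentials of the families are close on most of the circle. -/
lemma tendsto_average_circleLog_sub (c : ℂ) {R : ℝ} (hR : 0 < R) {W V : (n : ℕ) → Fin n → ℂ}
    {B : ℕ → Set ℝ} {ε : ℕ → ℝ} (hB : ∀ᶠ n in atTop, MeasurableSet (B n))
    (hBν : Tendsto (fun n => angleMeasure (B n)) atTop (𝓝 0)) (hε : Tendsto ε atTop (𝓝 0))
    (hWV : ∀ᶠ n in atTop, ∀ θ ∉ B n,
      |(n : ℝ)⁻¹ * ∑ k, (Real.log ‖circleMap c R θ - W n k‖ -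
        Real.log ‖circleMap c R θ - V n k‖)| ≤ ε n) :
    Tendsto (fun n : ℕ => (n : ℝ)⁻¹ * ∑ k, (circleLog c R (W n k) - circleLog c R (V n k))) atTop
      (𝓝 0) := by
  have hint : ∀ n, ∀ k : Fin n, Integrable
      (fun θ => centredLog c R (W n k) θ - centredLog c R (V n k) θ) angleMeasure := fun n k =>
    (integrable_centredLog _ _ _).sub (integrable_centredLog _ _ _)
  -- Cauchy–Schwarz on the average, then `(u - v)² ≤ 2u² + 2v²`; the two factors 2 give `K = 4 *
  -- logSqConst` below.
  have hsq : ∀ (n : ℕ) (θ : ℝ), ((n : ℝ)⁻¹ * ∑ k, (centredLog c R (W n k) θ - centredLog c R (V n k) θ)) ^ 2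
      ≤ (n : ℝ)⁻¹ * ∑ k, (2 * centredLog c R (W n k) θ ^ 2 + 2 * centredLog c R (V n k) θ ^ 2) := by
    intro n θ
    rcases n.eq_zero_or_pos with rfl | hn
    · simp
    have hn' : (0 : ℝ) < n := by exact_mod_cast hn
    have h1 := sq_sum_le_card_mul_sum_sq (s := (Finset.univ : Finset (Fin n)))
      (f := fun k => centredLog c R (W n k) θ - centredLog c R (V n k) θ)
    rw [Finset.card_univ, Fintype.card_fin] at h1
    rw [mul_pow]
    calc _ ≤ (n : ℝ)⁻¹ ^ 2 *
          (n * ∑ k, (centredLog c R (W n k) θ - centredLog c R (V n k) θ) ^ 2) := by gcongr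
      _ = (n : ℝ)⁻¹ * ∑ k, (centredLog c R (W n k) θ - centredLog c R (V n k) θ) ^ 2 := by
          field_simp
      _ ≤ _ := by
          gcongr with k
          nlinarith [sq_nonneg (centredLog c R (W n k) θ + centredLog c R (V n k) θ)]
  have hint2 : ∀ n : ℕ, Integrable (fun θ => (n : ℝ)⁻¹ * ∑ k : Fin n,
      (2 * centredLog c R (W n k) θ ^ 2 + 2 * centredLog c R (V n k) θ ^ 2)) angleMeasure := fun n =>
    (integrable_finsetSum _ fun k _ => ((integrable_centredLog_sq c hR _).const_mul 2).add
      ((integrable_centredLog_sq c hR _).const_mul 2)).const_mul _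
  have hint3 : ∀ n : ℕ, Integrable (fun θ => ((n : ℝ)⁻¹ * ∑ k : Fin n,
      (centredLog c R (W n k) θ - centredLog c R (V n k) θ)) ^ 2) angleMeasure := by
    intro n
    refine (hint2 n).mono' (Measurable.aestronglyMeasurable ?_) (ae_of_all _ fun θ => ?_)
    · exact ((Finset.measurable_fun_sum _ fun k _ => (measurable_centredLog _ _ _).sub
        (measurable_centredLog _ _ _)).const_mul _).pow_const _
    · rw [Real.norm_of_nonneg (sq_nonneg _)]
      exact hsq n θ
  -- Here `d n` is the average difference of the circle means, so `F n + d n` is the average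
  -- difference of the uncentred logarithms.
  refine tendsto_zero_of_integral_sq_le angleMeasure_ne_zero (K := 4 * logSqConst) (B := B) (ε := ε)
    (F := fun n θ => (n : ℝ)⁻¹ * ∑ k : Fin n, (centredLog c R (W n k) θ - centredLog c R (V n k) θ))
    (Eventually.of_forall fun n => (integrable_finsetSum _ fun k _ => hint n k).const_mul _)
    (Eventually.of_forall fun n => ?_) (Eventually.of_forall hint3) ?_ hB ?_ hε ?_
  · rw [integral_const_mul, integral_finsetSum _ fun k _ => hint n k]
    simp only [integral_sub (integrable_centredLog c R _) (integrable_centredLog c R _),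
      integral_centredLog c hR]
    simp
  · filter_upwards [eventually_gt_atTop 0] with n hn
    have hn' : (0 : ℝ) < n := by exact_mod_cast hn
    refine (integral_mono (hint3 n) (hint2 n) (hsq n)).trans ?_
    have hsum := integral_finsetSum (μ := angleMeasure) Finset.univ
      (f := fun k θ => 2 * centredLog c R (W n k) θ ^ 2 + 2 * centredLog c R (V n k) θ ^ 2)
      fun k _ => ((integrable_centredLog_sq c hR _).const_mul 2).add
        ((integrable_centredLog_sq c hR _).const_mul 2)
    rw [integral_const_mul, hsum, inv_mul_le_iff₀ hn']
    refine (Finset.sum_le_card_nsmul _ _ (4 * logSqConst) fun k _ => ?_).trans (by simp)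
    rw [integral_add ((integrable_centredLog_sq c hR _).const_mul 2)
      ((integrable_centredLog_sq c hR _).const_mul 2), integral_const_mul, integral_const_mul]
    linarith [integral_centredLog_sq_le c hR (W n k), integral_centredLog_sq_le c hR (V n k)]
  · have := (ENNReal.tendsto_toReal ENNReal.zero_ne_top).comp hBν
    exact this
  · filter_upwards [hWV] with n hn θ hθ
    convert hn θ hθ using 2
    rw [← mul_add, ← Finset.sum_add_distrib]
    congr 1
    refine Finset.sum_congr rfl fun k _ => ?_
    simp only [centredLog]
    ring

/-! ### Concentration and tail of the Gamma law -/

/-- From `y ≤ exp y` at `y = x / a`, raised to the power `a`. It trades the exponential factor of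
the Gamma density for a power. -/
lemma rpow_le_mul_exp {a x : ℝ} (ha : 0 < a) (hx : 0 ≤ x) : x ^ a ≤ a ^ a * Real.exp x := by
  have h1 : x / a ≤ Real.exp (x / a) := by linarith [Real.add_one_le_exp (x / a)]
  have h2 := Real.rpow_le_rpow (by positivity) h1 ha.le
  rw [← Real.exp_mul, div_mul_cancel₀ _ ha.ne', Real.div_rpow hx ha.le,
    div_le_iff₀ (Real.rpow_pos_of_pos ha _)] at h2
  linarith

lemma gammaMeasure_Iio_zero (a r : ℝ) : gammaMeasure a r (Set.Iio 0) = 0 := by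
  rw [gammaMeasure, withDensity_apply _ measurableSet_Iio, lintegral_gammaPDF_of_nonpos le_rfl]

lemma ae_gammaMeasure_pos (a r : ℝ) : ∀ᵐ x ∂gammaMeasure a r, 0 < x := by
  rw [ae_iff]
  have : {x : ℝ | ¬ 0 < x} = Set.Iio 0 ∪ {0} := by
    ext x
    simp [le_iff_lt_or_eq]
  rw [this]
  refine measure_union_null (gammaMeasure_Iio_zero a r) ?_
  rw [gammaMeasure, withDensity_apply _ (measurableSet_singleton 0)]
  simp

/-- Probability that a Gamma variable is close to a given number. -/
lemma exists_gammaMeasure_Icc_le {a : ℝ} (ha : 0 < a) :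
    ∃ C : ℝ, 0 ≤ C ∧ ∀ δ : ℝ, 0 < δ → ∀ x : ℝ,
      gammaMeasure a 1 (Set.Icc (x - δ) (x + δ)) ≤
        ENNReal.ofReal (C * (δ ^ (a / 2) + δ ^ (1 / 2 : ℝ))) := by
  have hΓ := Real.Gamma_pos_of_pos ha
  refine ⟨(a * Real.Gamma a)⁻¹ + 2 * a ^ a / Real.Gamma a, by positivity, fun δ hδ x => ?_⟩
  -- The density may blow up at 0, so split at `√δ`. Below, integrating `y ^ (a - 1)` gives `δ ^ (a
  -- / 2)`; above, the density is `O(1 / √δ)` on an interval of length `2δ`.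
  set s := δ ^ (1 / 2 : ℝ) with hs
  have hs0 : 0 < s := by positivity
  have hss : s * s = δ := by
    rw [hs, ← Real.rpow_add hδ]; norm_num
  have hsa : s ^ a = δ ^ (a / 2) := by
    rw [hs, ← Real.rpow_mul hδ.le]; ring_nf
  have hsub : Set.Icc (x - δ) (x + δ) ⊆
      Set.Iio 0 ∪ (Set.Icc 0 s ∪ (Set.Icc (x - δ) (x + δ) ∩ Set.Ioi s)) := by
    intro y hy
    rcases lt_or_ge y 0 with h | h
    · exact Or.inl h
    rcases le_or_gt y s with h' | h'
    · exact Or.inr (Or.inl ⟨h, h'⟩)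
    · exact Or.inr (Or.inr ⟨hy, h'⟩)
  have h1 : gammaMeasure a 1 (Set.Icc 0 s) ≤ ENNReal.ofReal ((a * Real.Gamma a)⁻¹ * δ ^ (a / 2)) := by
    rw [gammaMeasure, withDensity_apply _ measurableSet_Icc]
    calc ∫⁻ y in Set.Icc 0 s, gammaPDF a 1 y
        ≤ ∫⁻ y in Set.Icc 0 s, ENNReal.ofReal ((Real.Gamma a)⁻¹ * y ^ (a - 1)) := by
          refine setLIntegral_mono' measurableSet_Icc fun y hy => ?_
          rw [gammaPDF_of_nonneg hy.1]
          refine ENNReal.ofReal_le_ofReal ?_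
          rw [Real.one_rpow, one_div, one_mul]
          refine mul_le_of_le_one_right (mul_nonneg (by positivity) (Real.rpow_nonneg hy.1 _)) ?_
          rw [Real.exp_le_one_iff]
          linarith [hy.1]
      _ = ENNReal.ofReal (∫ y in Set.Icc 0 s, (Real.Gamma a)⁻¹ * y ^ (a - 1)) := by
          rw [ofReal_integral_eq_lintegral_ofReal]
          · refine Integrable.const_mul ?_ _
            rw [← IntegrableOn, integrableOn_Icc_iff_integrableOn_Ioc]
            exact (intervalIntegrable_iff_integrableOn_Ioc_of_le hs0.le).1
              (intervalIntegral.intervalIntegrable_rpow' (by linarith))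
          · filter_upwards [ae_restrict_mem measurableSet_Icc] with y hy
            exact mul_nonneg (by positivity) (Real.rpow_nonneg hy.1 _)
      _ = _ := by
          rw [integral_Icc_eq_integral_Ioc, ← intervalIntegral.integral_of_le hs0.le,
            intervalIntegral.integral_const_mul, integral_rpow (Or.inl (by linarith)),
            sub_add_cancel, Real.zero_rpow ha.ne', hsa]
          congr 1
          field_simp
          ring
  have h2 : gammaMeasure a 1 (Set.Icc (x - δ) (x + δ) ∩ Set.Ioi s) ≤
      ENNReal.ofReal (2 * a ^ a / Real.Gamma a * δ ^ (1 / 2 : ℝ)) := by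
    rw [gammaMeasure, withDensity_apply _ (measurableSet_Icc.inter measurableSet_Ioi)]
    calc ∫⁻ y in Set.Icc (x - δ) (x + δ) ∩ Set.Ioi s, gammaPDF a 1 y
        ≤ ∫⁻ y in Set.Icc (x - δ) (x + δ) ∩ Set.Ioi s, ENNReal.ofReal (a ^ a / Real.Gamma a / s) := by
          refine setLIntegral_mono' (measurableSet_Icc.inter measurableSet_Ioi) fun y hy => ?_
          have hsy : s < y := hy.2
          have hy0 : 0 < y := hs0.trans hsy
          rw [gammaPDF_of_nonneg hy0.le]
          refine ENNReal.ofReal_le_ofReal ?_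
          rw [Real.one_rpow, one_mul, Real.rpow_sub_one hy0.ne', Real.exp_neg]
          have h3 := rpow_le_mul_exp ha hy0.le
          calc 1 / Real.Gamma a * (y ^ a / y) * (Real.exp y)⁻¹
              = y ^ a / Real.exp y / Real.Gamma a / y := by field_simp
            _ ≤ a ^ a / Real.Gamma a / s := by
                gcongr
                rwa [div_le_iff₀ (Real.exp_pos y)]
      _ = ENNReal.ofReal (a ^ a / Real.Gamma a / s) *
            volume (Set.Icc (x - δ) (x + δ) ∩ Set.Ioi s) := setLIntegral_const _ _
      _ ≤ ENNReal.ofReal (a ^ a / Real.Gamma a / s) * volume (Set.Icc (x - δ) (x + δ)) := by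
          gcongr
          exact Set.inter_subset_left
      _ = _ := by
          rw [Real.volume_Icc, ← ENNReal.ofReal_mul (by positivity), ← hs]
          congr 1
          rw [show x + δ - (x - δ) = 2 * (s * s) by rw [hss]; ring]
          field_simp
  refine (measure_mono hsub).trans ((measure_union_le _ _).trans ?_)
  rw [gammaMeasure_Iio_zero, zero_add]
  refine (measure_union_le _ _).trans ((add_le_add h1 h2).trans ?_)
  rw [← ENNReal.ofReal_add (by positivity) (by positivity)]
  refine ENNReal.ofReal_le_ofReal ?_
  have e1 : 0 ≤ (a * Real.Gamma a)⁻¹ * δ ^ (1 / 2 : ℝ) := by positivity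
  have e2 : 0 ≤ 2 * a ^ a / Real.Gamma a * δ ^ (a / 2) := by positivity
  nlinarith

/-- The density is at most a constant times `y ^ (-2)`. This crude tail suffices, since the
threshold will be `n ^ 4`. -/
lemma exists_gammaMeasure_Ioi_le {a : ℝ} (ha : 0 < a) :
    ∃ C : ℝ, 0 ≤ C ∧ ∀ t : ℝ, 0 < t → gammaMeasure a 1 (Set.Ioi t) ≤ ENNReal.ofReal (C / t) := by
  have hΓ := Real.Gamma_pos_of_pos ha
  refine ⟨(a + 1) ^ (a + 1) / Real.Gamma a, by positivity, fun t ht => ?_⟩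
  rw [gammaMeasure, withDensity_apply _ measurableSet_Ioi]
  calc ∫⁻ y in Set.Ioi t, gammaPDF a 1 y
      ≤ ∫⁻ y in Set.Ioi t, ENNReal.ofReal ((a + 1) ^ (a + 1) / Real.Gamma a * y ^ (-2 : ℝ)) := by
        refine setLIntegral_mono' measurableSet_Ioi fun y hy => ?_
        have hy0 : 0 < y := ht.trans hy
        rw [gammaPDF_of_nonneg hy0.le]
        refine ENNReal.ofReal_le_ofReal ?_
        have h3 := rpow_le_mul_exp (show 0 < a + 1 by linarith) hy0.le
        rw [Real.one_rpow, one_mul, show a - 1 = (a + 1) + (-2) by ring, Real.rpow_add hy0,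
          Real.exp_neg]
        calc 1 / Real.Gamma a * (y ^ (a + 1) * y ^ (-2 : ℝ)) * (Real.exp y)⁻¹
            = y ^ (a + 1) / Real.exp y / Real.Gamma a * y ^ (-2 : ℝ) := by field_simp
          _ ≤ _ := by
              gcongr
              rwa [div_le_iff₀ (Real.exp_pos y)]
    _ = ENNReal.ofReal (∫ y in Set.Ioi t, (a + 1) ^ (a + 1) / Real.Gamma a * y ^ (-2 : ℝ)) := by
        rw [ofReal_integral_eq_lintegral_ofReal]
        · exact (integrableOn_Ioi_rpow_of_lt (by norm_num) ht).const_mul _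
        · filter_upwards [ae_restrict_mem measurableSet_Ioi] with y hy
          have := ht.trans hy
          positivity
    _ = _ := by
        rw [integral_const_mul, integral_Ioi_rpow_of_lt (by norm_num) ht]
        congr 1
        rw [show (-2 : ℝ) + 1 = -1 by norm_num, Real.rpow_neg_one]
        field_simp

/-- Probability that a Gamma variable is close to an independent variable. -/
lemma measure_abs_sub_le_of_indepFun {Ω : Type*} [MeasurableSpace Ω] {P : Measure Ω}
    [IsProbabilityMeasure P] {κ : Measure ℝ} {g X : Ω → ℝ} (hg : Measurable g) (hX : Measurable X)
    (hlaw : P.map g = κ) (hind : IndepFun X g P) {δ : ℝ} {p : ENNReal}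
    (h : ∀ x, κ (Set.Icc (x - δ) (x + δ)) ≤ p) : P {ω | |g ω - X ω| ≤ δ} ≤ p := by
  have hp : P.map (fun ω => (X ω, g ω)) = (P.map X).prod κ := by
    rw [← hlaw]
    exact (indepFun_iff_map_prod_eq_prod_map_map hX.aemeasurable hg.aemeasurable).1 hind
  have : IsProbabilityMeasure κ := hlaw ▸ Measure.isProbabilityMeasure_map hg.aemeasurable
  have : IsProbabilityMeasure (P.map X) := Measure.isProbabilityMeasure_map hX.aemeasurable
  have hS : MeasurableSet {q : ℝ × ℝ | |q.2 - q.1| ≤ δ} :=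
    measurableSet_le (by fun_prop) measurable_const
  have h1 : P {ω | |g ω - X ω| ≤ δ} = P.map (fun ω => (X ω, g ω)) {q : ℝ × ℝ | |q.2 - q.1| ≤ δ} := by
    rw [Measure.map_apply (by fun_prop) hS]
    rfl
  rw [h1, hp, Measure.prod_apply hS]
  calc _ ≤ ∫⁻ x, p ∂P.map X := by
        refine lintegral_mono fun x => le_trans (le_of_eq ?_) (h x)
        congr 1
        ext y
        simp only [Set.mem_preimage, Set.mem_ofPred_eq, Set.mem_Icc, abs_le]
        constructor <;> rintro ⟨h1, h2⟩ <;> constructor <;> linarith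
    _ = p := by simp

/-! ### The circular derivative -/

section Polynomial

variable {n : ℕ} {g : Fin n → ℝ} {z w : Fin n → ℂ}

open Polynomial in
lemma coeff_circularDerivative (g : Fin n → ℝ) (z : Fin n → ℂ) :
    (circularDerivative g z).coeff n = ∑ k, (g k : ℂ) := by
  rw [circularDerivative, finsetSum_coeff]
  refine Finset.sum_congr rfl fun k _ => ?_
  have hn : n = ((Finset.univ.erase k).card) + 1 := by
    rw [Finset.card_erase_add_one (Finset.mem_univ k)]
    simp
  have hm : (∏ l ∈ Finset.univ.erase k, (X - C (z l))).Monic :=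
    monic_prod_of_monic _ _ fun l _ => monic_X_sub_C _
  have hd : (∏ l ∈ Finset.univ.erase k, (X - C (z l))).natDegree = (Finset.univ.erase k).card := by
    rw [natDegree_prod_of_monic _ _ fun l _ => monic_X_sub_C _]
    simp
  have hm2 := (monic_X_add_C (z k)).mul hm
  have hd2 : ((X + C (z k)) * ∏ l ∈ Finset.univ.erase k, (X - C (z l))).natDegree = n := by
    rw [(monic_X_add_C (z k)).natDegree_mul hm, hd, natDegree_X_add_C, add_comm, ← hn]
  rw [mul_assoc, coeff_C_mul]
  have h1 := hm2.coeff_natDegree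
  rw [hd2] at h1
  rw [h1, mul_one]

open Polynomial in
lemma natDegree_circularDerivative_le (g : Fin n → ℝ) (z : Fin n → ℂ) :
    (circularDerivative g z).natDegree ≤ n := by
  refine natDegree_sum_le_of_forall_le _ _ fun k _ => ?_
  have hn : n = 0 + 1 + ((Finset.univ.erase k).card) := by
    rw [zero_add, add_comm, Finset.card_erase_add_one (Finset.mem_univ k)]
    simp
  refine natDegree_mul_le.trans ?_
  conv_rhs => rw [hn]
  refine add_le_add (natDegree_mul_le.trans (add_le_add (natDegree_C _).le ?_)) ?_
  · rw [natDegree_X_add_C]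
  · refine (natDegree_prod_le _ _).trans ?_
    simp

open Polynomial in
/-- The circular derivative factors over its zeros. -/
lemma circularDerivative_eq_of_roots
    (hroots : Finset.univ.val.map w = (circularDerivative g z).roots) :
    circularDerivative g z = C (∑ k, (g k : ℂ)) * ∏ k, (X - C (w k)) := by
  have hcard : (circularDerivative g z).roots.card = n := by simp [← hroots]
  -- Having `n` roots already forces degree `n`; no positivity of the weights is needed here.
  have hdeg : (circularDerivative g z).natDegree = n :=
    le_antisymm (natDegree_circularDerivative_le g z) (hcard.ge.trans (card_roots' _))
  have h := C_leadingCoeff_mul_prod_multiset_X_sub_C (hcard.trans hdeg.symm)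
  rw [leadingCoeff, hdeg, coeff_circularDerivative, ← hroots, Multiset.map_map] at h
  exact h.symm

lemma eval_circularDerivative {x : ℂ} (hx : ∀ k, x ≠ z k) :
    (circularDerivative g z).eval x =
      (∑ k, (g k : ℂ) * ((x + z k) / (x - z k))) * ∏ k, (x - z k) := by
  rw [circularDerivative, Polynomial.eval_finsetSum, Finset.sum_mul]
  refine Finset.sum_congr rfl fun k _ => ?_
  rw [← Finset.mul_prod_erase Finset.univ (fun k => x - z k) (Finset.mem_univ k)]
  have := sub_ne_zero.2 (hx k)
  simp only [Polynomial.eval_mul, Polynomial.eval_C, Polynomial.eval_add, Polynomial.eval_X,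
    Polynomial.eval_prod, Polynomial.eval_sub]
  field_simp

/-- The basic identity: after `log ‖·‖` it expresses the change of the potential by two sums over
the weights. -/
lemma sum_mul_prod_eq_of_roots
    (hroots : Finset.univ.val.map w = (circularDerivative g z).roots) {x : ℂ} (hx : ∀ k, x ≠ z k) :
    (∑ k, (g k : ℂ)) * ∏ k, (x - w k) =
      (∑ k, (g k : ℂ) * ((x + z k) / (x - z k))) * ∏ k, (x - z k) := by
  rw [← eval_circularDerivative hx, circularDerivative_eq_of_roots hroots]
  simp [Polynomial.eval_prod, Polynomial.eval_finsetSum]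

/-- The number near which the weight of index `k` has to lie for the circular derivative to be
small at `x`. -/
noncomputable def criticalWeight (k : Fin n) (g : Fin n → ℝ) (z : Fin n → ℂ) (x : ℂ) : ℝ :=
  (-(∑ l ∈ Finset.univ.erase k, (g l : ℂ) * ((x + z l) / (x - z l))) /
    ((x + z k) / (x - z k))).re

/-- The sum is affine in `g k` with slope `(x + z k) / (x - z k)`. As `g k` is real, its distance to
the complex zero is at least that to the real part of this zero. -/
lemma norm_mul_abs_sub_criticalWeight_le (k : Fin n) (g : Fin n → ℝ) (z : Fin n → ℂ) {x : ℂ}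
    (hx : x ≠ z k) (hx' : x ≠ -z k) :
    ‖(x + z k) / (x - z k)‖ * |g k - criticalWeight k g z x| ≤
      ‖∑ l, (g l : ℂ) * ((x + z l) / (x - z l))‖ := by
  set a := (x + z k) / (x - z k) with ha
  have ha0 : a ≠ 0 := div_ne_zero (fun h => hx' (eq_neg_of_add_eq_zero_left h)) (sub_ne_zero.2 hx)
  set b := ∑ l ∈ Finset.univ.erase k, (g l : ℂ) * ((x + z l) / (x - z l)) with hb
  have h1 : ∑ l, (g l : ℂ) * ((x + z l) / (x - z l)) = a * (g k - -b / a) := by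
    rw [← Finset.add_sum_erase _ _ (Finset.mem_univ k), ← hb, ← ha]
    field_simp
    ring
  rw [h1, norm_mul]
  refine mul_le_mul_of_nonneg_left ?_ (norm_nonneg _)
  refine le_trans (le_of_eq ?_) (Complex.abs_re_le_norm _)
  rw [Complex.sub_re, Complex.ofReal_re, criticalWeight, ← hb, ← ha]

/-- One iteration of the circular derivative changes the logarithmic potential at a good point by
at most a logarithm. -/
lemma abs_sum_log_sub_log_le
    (hroots : Finset.univ.val.map w = (circularDerivative g z).roots) {x : ℂ} {ε δ T M : ℝ}
    (hε : 0 < ε) (hδ : 0 < δ) (k : Fin n) (hg : ∀ l, 0 < g l) (hgT : ∀ l, g l ≤ T)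
    (hx : ∀ l, ε < ‖x - z l‖) (hx' : ∀ l, ε < ‖x + z l‖)
    (hk : δ < |g k - criticalWeight k g z x|) (hM : 1 + 2 * ‖x‖ / ε ≤ M)
    (hM' : n * T * (1 + 2 * ‖x‖ / ε) / δ ≤ M) :
    |∑ l, (Real.log ‖x - w l‖ - Real.log ‖x - z l‖)| ≤ Real.log M := by
  have hxz : ∀ l, x ≠ z l := fun l h => by
    have := hx l
    rw [h, sub_self, norm_zero] at this
    linarith
  have hxz' : ∀ l, x ≠ -z l := fun l h => by
    have := hx' l
    rw [h, neg_add_cancel, norm_zero] at this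
    linarith
  set A := 1 + 2 * ‖x‖ / ε with hA
  have hA1 : 1 ≤ A := le_add_of_nonneg_right (by positivity)
  -- Since `(x + z) + (x - z) = 2x`, one estimate covers the ratio and its inverse.
  have hratio : ∀ u v : ℂ, ε < ‖v‖ → ‖u + v‖ = ‖2 * x‖ → ‖u / v‖ ≤ A := by
    intro u v hv huv
    have hv0 : 0 < ‖v‖ := hε.trans hv
    rw [norm_div, div_le_iff₀ hv0, hA, add_mul, one_mul]
    have h1 : ‖u‖ ≤ ‖v‖ + 2 * ‖x‖ := by
      have := norm_sub_le (u + v) v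
      rw [huv, add_sub_cancel_right, norm_mul, Complex.norm_two] at this
      linarith
    have h2 : 2 * ‖x‖ ≤ 2 * ‖x‖ / ε * ‖v‖ := by
      rw [div_mul_eq_mul_div, le_div_iff₀ hε]
      exact mul_le_mul_of_nonneg_left hv.le (by positivity)
    linarith
  have ha : ∀ l, ‖(x + z l) / (x - z l)‖ ≤ A := fun l => hratio _ _ (hx l) (by ring_nf)
  have ha' : ‖(x - z k) / (x + z k)‖ ≤ A := hratio _ _ (hx' k) (by ring_nf)
  set S := ∑ l, (g l : ℂ) * ((x + z l) / (x - z l)) with hS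
  have hsum0 : 0 < ∑ l, g l := Finset.sum_pos (fun l _ => hg l) ⟨k, Finset.mem_univ k⟩
  have hsumT : ∑ l, g l ≤ n * T := by
    refine (Finset.sum_le_card_nsmul _ _ T fun l _ => hgT l).trans (by simp)
  have hS_le : ‖S‖ ≤ (∑ l, g l) * M := by
    refine (norm_sum_le _ _).trans ?_
    rw [Finset.sum_mul]
    refine Finset.sum_le_sum fun l _ => ?_
    rw [norm_mul, Complex.norm_real, Real.norm_of_nonneg (hg l).le]
    exact mul_le_mul_of_nonneg_left ((ha l).trans hM) (hg l).le
  have hM0 : 0 < M := by linarith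
  -- The slope in `g k` is at least `1 / A` in norm, so `‖S‖ ≥ δ / A`, whereas the sum of the
  -- weights is at most `n * T`.
  have hS_ge : ∑ l, g l ≤ ‖S‖ * M := by
    have h1 := norm_mul_abs_sub_criticalWeight_le k g z (hxz k) (hxz' k)
    have h2 : 1 ≤ A * ‖(x + z k) / (x - z k)‖ := by
      rw [← inv_div, norm_inv] at ha'
      have h0 : 0 < ‖(x + z k) / (x - z k)‖ :=
        norm_pos_iff.2 (div_ne_zero (fun h => hxz' k (eq_neg_of_add_eq_zero_left h))
          (sub_ne_zero.2 (hxz k)))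
      rwa [inv_le_iff_one_le_mul₀ h0] at ha'
    have h3 : δ ≤ A * ‖S‖ := by
      calc δ = δ * 1 := (mul_one δ).symm
        _ ≤ |g k - criticalWeight k g z x| * (A * ‖(x + z k) / (x - z k)‖) :=
            mul_le_mul hk.le h2 zero_le_one (abs_nonneg _)
        _ = A * (‖(x + z k) / (x - z k)‖ * |g k - criticalWeight k g z x|) := by ring
        _ ≤ A * ‖S‖ := mul_le_mul_of_nonneg_left h1 (by linarith)
    have hnT : 0 < n * T := hsum0.trans_le hsumT
    calc ∑ l, g l ≤ n * T := hsumT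
      _ = n * T * δ / δ := by field_simp
      _ ≤ n * T * (A * ‖S‖) / δ := by gcongr
      _ = ‖S‖ * (n * T * A / δ) := by ring
      _ ≤ ‖S‖ * M := mul_le_mul_of_nonneg_left hM' (norm_nonneg _)
  have hSpos : 0 < ‖S‖ := pos_of_mul_pos_left (hsum0.trans_le hS_ge) hM0.le
  have hprod := sum_mul_prod_eq_of_roots hroots hxz
  rw [← hS] at hprod
  have hz0 : ∀ l, ‖x - z l‖ ≠ 0 := fun l => norm_ne_zero_iff.2 (sub_ne_zero.2 (hxz l))
  have hw0 : ∀ l, ‖x - w l‖ ≠ 0 := by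
    intro l hl
    rw [norm_eq_zero] at hl
    rw [Finset.prod_eq_zero (Finset.mem_univ l) hl, mul_zero, eq_comm, mul_eq_zero,
      Finset.prod_eq_zero_iff] at hprod
    rcases hprod with h | ⟨i, -, h⟩
    · exact hSpos.ne' (by rw [h, norm_zero])
    · exact hz0 i (by rw [h, norm_zero])
  have hlog := congrArg (fun y : ℂ => Real.log ‖y‖) hprod
  simp only [norm_mul, norm_prod] at hlog
  have hcast : ‖∑ l, (g l : ℂ)‖ = ∑ l, g l := by
    rw [← Complex.ofReal_sum, Complex.norm_real, Real.norm_of_nonneg hsum0.le]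
  rw [hcast, Real.log_mul hsum0.ne' (Finset.prod_ne_zero_iff.2 fun l _ => hw0 l),
    Real.log_mul hSpos.ne' (Finset.prod_ne_zero_iff.2 fun l _ => hz0 l),
    Real.log_prod fun l _ => hw0 l, Real.log_prod fun l _ => hz0 l] at hlog
  rw [Finset.sum_sub_distrib, abs_le]
  have l1 := Real.log_le_log hSpos hS_le
  have l2 := Real.log_le_log hsum0 hS_ge
  rw [Real.log_mul hsum0.ne' hM0.ne'] at l1
  rw [Real.log_mul hSpos.ne' hM0.ne'] at l2
  constructor <;> linarith

end Polynomial

/-! ### Independence of a weight from the past and from the other weights -/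

/-- The joint law of the triple factors completely, up to reassociation. Used with the initial
points, all other weights, and one distinguished weight. -/
lemma indepFun_prodMk_of_indepFun {Ω α β δ : Type*} [MeasurableSpace Ω] [MeasurableSpace α]
    [MeasurableSpace β] [MeasurableSpace δ] {P : Measure Ω} [IsProbabilityMeasure P]
    {X : Ω → α} {Y : Ω → β} {W : Ω → δ} (hX : Measurable X) (hY : Measurable Y) (hW : Measurable W)
    (h1 : IndepFun X (fun ω => (Y ω, W ω)) P) (h2 : IndepFun Y W P) :
    IndepFun (fun ω => (X ω, Y ω)) W P := by
  have := Measure.isProbabilityMeasure_map (μ := P) hX.aemeasurable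
  have := Measure.isProbabilityMeasure_map (μ := P) hY.aemeasurable
  have := Measure.isProbabilityMeasure_map (μ := P) hW.aemeasurable
  have h3 : IndepFun X Y P := h1.comp measurable_id measurable_fst
  rw [indepFun_iff_map_prod_eq_prod_map_map (by fun_prop) (by fun_prop)] at h1 h2 h3 ⊢
  rw [h3]
  rw [h2] at h1
  refine (MeasurableEquiv.prodAssoc (α := α) (β := β) (γ := δ)).map_measurableEquiv_injective ?_
  rw [Measure.prodAssoc_prod, ← h1, Measure.map_map (by fun_prop) (by fun_prop)]
  rfl

/-- Only the weights of index `l ≠ k` need be measurable; this is what makes the critical value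
independent of the weight `k`. -/
lemma measurable_criticalWeight {α : Type*} [MeasurableSpace α] {n : ℕ} {k : Fin n}
    {g : α → Fin n → ℝ} {z : α → Fin n → ℂ} {x : α → ℂ}
    (hg : ∀ l ≠ k, Measurable fun a => g a l) (hz : ∀ l, Measurable fun a => z a l)
    (hx : Measurable x) : Measurable fun a => criticalWeight k (g a) (z a) (x a) := by
  unfold criticalWeight
  have h1 : Measurable fun a => ∑ l ∈ Finset.univ.erase k,
      (g a l : ℂ) * ((x a + z a l) / (x a - z a l)) := by
    refine Finset.measurable_fun_sum _ fun l hl => ?_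
    have := hg l (Finset.ne_of_mem_erase hl)
    have := hz l
    fun_prop
  have := hz k
  fun_prop

lemma circularPast_le {Ω : Type*} [MeasurableSpace Ω] {n m : ℕ} {Z₀ : Fin n → Ω → ℂ}
    {γ : Fin m → Fin n → Ω → ℝ} (hZ : ∀ k, Measurable (Z₀ k)) (hγ : ∀ j k, Measurable (γ j k))
    (j : ℕ) : circularPast Z₀ γ j ≤ (inferInstance : MeasurableSpace Ω) :=
  sup_le (iSup_le fun k => (hZ k).comap_le)
    (iSup_le fun i => iSup_le fun _ => iSup_le fun k => (hγ i k).comap_le)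

/-- The critical value of a weight is independent of this weight. -/
lemma indepFun_criticalWeight {Ω : Type*} [MeasurableSpace Ω] {P : Measure Ω}
    [IsProbabilityMeasure P] {n m : ℕ} {Z₀ : Fin n → Ω → ℂ} {γ : Fin m → Fin n → Ω → ℝ}
    (hZ : ∀ k, Measurable (Z₀ k)) (hγ : ∀ j k, Measurable (γ j k))
    (hγ_indep : iIndepFun (fun p : Fin m × Fin n => γ p.1 p.2) P)
    (hZγ : IndepFun (fun ω k => Z₀ k ω) (fun ω (p : Fin m × Fin n) => γ p.1 p.2 ω) P)
    (j : Fin m) (k : Fin n) {V : Fin n → Ω → ℂ}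
    (hV : ∀ l, Measurable[circularPast Z₀ γ j.val] (V l)) (x : ℂ) :
    IndepFun (fun ω => criticalWeight k (fun l => γ j l ω) (fun l => V l ω) x) (γ j k) P := by
  set S : Finset (Fin m × Fin n) := Finset.univ.erase (j, k)
  -- `U` records everything except the weight `(j, k)`. The past of iteration `j` involves only
  -- earlier rows, hence is measurable with respect to `U`.
  set U : Ω → (Fin n → ℂ) × (S → ℝ) := fun ω => (fun k => Z₀ k ω, fun p => γ p.1.1 p.1.2 ω) with hU
  have hind : IndepFun U (γ j k) P := by
    refine indepFun_prodMk_of_indepFun (by fun_prop) (by fun_prop) (hγ j k) ?_ ?_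
    · exact hZγ.comp (φ := id) (ψ := fun a : Fin m × Fin n → ℝ =>
        ((fun p : S => a p.1), a (j, k))) measurable_id (by fun_prop)
    · have h := hγ_indep.indepFun_finset S {(j, k)} (by simp [S]) (fun p => hγ p.1 p.2)
      exact h.comp (φ := id) (ψ := fun a : ({(j, k)} : Finset (Fin m × Fin n)) → ℝ =>
        a ⟨(j, k), Finset.mem_singleton_self _⟩) measurable_id (measurable_pi_apply _)
  have hU_meas : Measurable[MeasurableSpace.comap U inferInstance] U := comap_measurable U
  have hZ' : ∀ l, Measurable[MeasurableSpace.comap U inferInstance] (Z₀ l) := fun l =>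
    ((measurable_pi_apply l).comp measurable_fst).comp hU_meas
  have hγ' : ∀ p : Fin m × Fin n, p ≠ (j, k) →
      Measurable[MeasurableSpace.comap U inferInstance] (γ p.1 p.2) := fun p hp =>
    ((measurable_pi_apply (⟨p, by simp [S, hp]⟩ : S)).comp measurable_snd).comp hU_meas
  have hpast : circularPast Z₀ γ j.val ≤ MeasurableSpace.comap U inferInstance := by
    refine sup_le (iSup_le fun l => (hZ' l).comap_le)
      (iSup_le fun i => iSup_le fun hi => iSup_le fun l => (hγ' (i, l) ?_).comap_le)
    rintro h
    rw [(Prod.mk.inj h).1] at hi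
    exact lt_irrefl _ hi
  have hcrit : Measurable[MeasurableSpace.comap U inferInstance]
      (fun ω => criticalWeight k (fun l => γ j l ω) (fun l => V l ω) x) :=
    @measurable_criticalWeight Ω (MeasurableSpace.comap U inferInstance) n k
      (fun ω l => γ j l ω) (fun ω l => V l ω) (fun _ => x)
      (fun l hl => hγ' (j, l) fun h => hl (Prod.mk.inj h).2)
      (fun l => (hV l).mono hpast le_rfl) measurable_const
  rw [IndepFun_iff_Indep] at hind ⊢
  exact indep_of_indep_of_le_left hind hcrit.comap_le

/-! ### The exceptional set -/

/-- The pairs of an outcome and an angle for which the iteration is not under control at the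
corresponding point of the circle. -/
def exceptionalSet {Ω : Type*} {n m : ℕ} (γ : Fin m → Fin n → Ω → ℝ)
    (Z : Fin (m + 1) → Fin n → Ω → ℂ) (c : ℂ) (R ε δ T : ℝ) : Set (Ω × ℝ) :=
  ((⋃ p : Fin (m + 1) × Fin n, {q | ‖circleMap c R q.2 - Z p.1 p.2 q.1‖ ≤ ε}) ∪
    ⋃ p : Fin (m + 1) × Fin n, {q | ‖circleMap c R q.2 + Z p.1 p.2 q.1‖ ≤ ε}) ∪
  ((⋃ p : Fin m × Fin n, {q | |γ p.1 p.2 q.1 - criticalWeight p.2 (fun l => γ p.1 l q.1)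
      (fun l => Z p.1.castSucc l q.1) (circleMap c R q.2)| ≤ δ}) ∪
    ⋃ p : Fin m × Fin n, {q | T < γ p.1 p.2 q.1})

section ExceptionalSet

variable {Ω : Type*} [MeasurableSpace Ω] {P : Measure Ω} {n m : ℕ}
  {γ : Fin m → Fin n → Ω → ℝ} {Z : Fin (m + 1) → Fin n → Ω → ℂ} {c : ℂ} {R ε δ T : ℝ}

lemma measurableSet_norm_circleMap_sub_le {V : Ω → ℂ} (hV : Measurable V) (c : ℂ) (R ε : ℝ) :
    MeasurableSet {q : Ω × ℝ | ‖circleMap c R q.2 - V q.1‖ ≤ ε} := by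
  have := (continuous_circleMap c R).measurable
  exact measurableSet_le (by fun_prop) measurable_const

lemma measurableSet_norm_circleMap_add_le {V : Ω → ℂ} (hV : Measurable V) (c : ℂ) (R ε : ℝ) :
    MeasurableSet {q : Ω × ℝ | ‖circleMap c R q.2 + V q.1‖ ≤ ε} := by
  simpa using measurableSet_norm_circleMap_sub_le hV.neg c R ε

lemma measurableSet_abs_sub_criticalWeight_le (hZ : ∀ j k, Measurable (Z j k))
    (hγ : ∀ j k, Measurable (γ j k)) (p : Fin m × Fin n) :
    MeasurableSet {q : Ω × ℝ | |γ p.1 p.2 q.1 - criticalWeight p.2 (fun l => γ p.1 l q.1)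
      (fun l => Z p.1.castSucc l q.1) (circleMap c R q.2)| ≤ δ} := by
  have h1 : Measurable fun q : Ω × ℝ => criticalWeight p.2 (fun l => γ p.1 l q.1)
      (fun l => Z p.1.castSucc l q.1) (circleMap c R q.2) :=
    measurable_criticalWeight (fun l _ => (hγ p.1 l).comp measurable_fst)
      (fun l => (hZ p.1.castSucc l).comp measurable_fst)
      ((continuous_circleMap c R).measurable.comp measurable_snd)
  exact measurableSet_le (((hγ p.1 p.2).comp measurable_fst).sub h1).abs measurable_const

lemma measurableSet_exceptionalSet (hZ : ∀ j k, Measurable (Z j k))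
    (hγ : ∀ j k, Measurable (γ j k)) : MeasurableSet (exceptionalSet γ Z c R ε δ T) := by
  unfold exceptionalSet
  refine MeasurableSet.union (MeasurableSet.union ?_ ?_) (MeasurableSet.union ?_ ?_)
  · exact MeasurableSet.iUnion fun p => measurableSet_norm_circleMap_sub_le (hZ p.1 p.2) c R ε
  · exact MeasurableSet.iUnion fun p => measurableSet_norm_circleMap_add_le (hZ p.1 p.2) c R ε
  · exact MeasurableSet.iUnion fun p => measurableSet_abs_sub_criticalWeight_le hZ hγ p
  · exact MeasurableSet.iUnion fun p => measurableSet_lt measurable_const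
      ((hγ p.1 p.2).comp measurable_fst)

lemma prod_norm_circleMap_sub_le [IsProbabilityMeasure P] (hR : 0 < R) (hε : 0 < ε) {V : Ω → ℂ}
    (hV : Measurable V) :
    P.prod angleMeasure {q : Ω × ℝ | ‖circleMap c R q.2 - V q.1‖ ≤ ε} ≤
      ENNReal.ofReal (sinConst * (ε / R) ^ (1 / 2 : ℝ)) := by
  rw [Measure.prod_apply (measurableSet_norm_circleMap_sub_le hV c R ε)]
  refine (lintegral_mono fun ω => angleMeasure_norm_circleMap_sub_le c hR (V ω) hε).trans ?_
  simp

lemma measure_iUnion_le_card_mul {α ι : Type*} [MeasurableSpace α] [Fintype ι] (ν : Measure α)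
    (s : ι → Set α) {b : ENNReal} (h : ∀ i, ν (s i) ≤ b) :
    ν (⋃ i, s i) ≤ Fintype.card ι * b :=
  (measure_iUnion_fintype_le ν s).trans
    ((Finset.sum_le_card_nsmul _ _ b fun i _ => h i).trans (by simp))

lemma angleMeasure_univ : angleMeasure Set.univ = ENNReal.ofReal (2 * Real.pi) := by
  simp [angleMeasure]

/-- A union bound. Distances are integrated over the angle at fixed outcome; critical weights over
the outcome at fixed angle, where independence applies. -/
lemma prod_exceptionalSet_le [IsProbabilityMeasure P] {κ : Measure ℝ} {p t : ENNReal}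
    (hZ_meas : ∀ j k, Measurable (Z j k)) (hγ_meas : ∀ j k, Measurable (γ j k))
    (hγ_law : ∀ j k, P.map (γ j k) = κ)
    (hγ_indep : iIndepFun (fun p : Fin m × Fin n => γ p.1 p.2) P)
    (hZγ : IndepFun (fun ω k => Z 0 k ω) (fun ω (p : Fin m × Fin n) => γ p.1 p.2 ω) P)
    (hlab : ∀ (j : Fin (m + 1)) (k : Fin n), Measurable[circularPast (Z 0) γ j.val] (Z j k))
    (hR : 0 < R) (hε : 0 < ε) (hp : ∀ x, κ (Set.Icc (x - δ) (x + δ)) ≤ p) (ht : κ (Set.Ioi T) ≤ t) :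
    P.prod angleMeasure (exceptionalSet γ Z c R ε δ T) ≤
      (2 * ((m + 1 : ℕ) * n * ENNReal.ofReal (sinConst * (ε / R) ^ (1 / 2 : ℝ)))) +
        m * n * (ENNReal.ofReal (2 * Real.pi) * (p + t)) := by
  have h1 := measure_iUnion_le_card_mul (P.prod angleMeasure) _
    fun p : Fin (m + 1) × Fin n => prod_norm_circleMap_sub_le (c := c) hR hε (hZ_meas p.1 p.2)
  have h2 := measure_iUnion_le_card_mul (P.prod angleMeasure) _
    fun p : Fin (m + 1) × Fin n => prod_norm_circleMap_sub_le (c := c) hR hε (hZ_meas p.1 p.2).neg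
  have h3 : ∀ i : Fin m × Fin n, P.prod angleMeasure {q : Ω × ℝ | |γ i.1 i.2 q.1 -
      criticalWeight i.2 (fun l => γ i.1 l q.1) (fun l => Z i.1.castSucc l q.1)
        (circleMap c R q.2)| ≤ δ} ≤ ENNReal.ofReal (2 * Real.pi) * p := by
    intro i
    rw [Measure.prod_apply_symm (measurableSet_abs_sub_criticalWeight_le hZ_meas hγ_meas i)]
    have : ∀ θ : ℝ, P ((fun ω => (ω, θ)) ⁻¹' {q : Ω × ℝ | |γ i.1 i.2 q.1 -
      criticalWeight i.2 (fun l => γ i.1 l q.1) (fun l => Z i.1.castSucc l q.1)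
        (circleMap c R q.2)| ≤ δ}) ≤ p := by
      intro θ
      exact measure_abs_sub_le_of_indepFun (hγ_meas i.1 i.2)
        (measurable_criticalWeight (fun l _ => hγ_meas i.1 l) (fun l => hZ_meas _ l)
          measurable_const) (hγ_law i.1 i.2)
        (indepFun_criticalWeight (hZ_meas 0) hγ_meas hγ_indep hZγ i.1 i.2
          (fun l => hlab i.1.castSucc l) (circleMap c R θ)) hp
    refine (lintegral_mono this).trans ?_
    rw [lintegral_const, angleMeasure_univ, mul_comm]
  have h4 : ∀ i : Fin m × Fin n, P.prod angleMeasure {q : Ω × ℝ | T < γ i.1 i.2 q.1} ≤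
      ENNReal.ofReal (2 * Real.pi) * t := by
    intro i
    have : {q : Ω × ℝ | T < γ i.1 i.2 q.1} = (γ i.1 i.2 ⁻¹' Set.Ioi T) ×ˢ Set.univ := by
      ext q; simp
    rw [this, Measure.prod_prod, angleMeasure_univ, mul_comm,
      ← Measure.map_apply (hγ_meas i.1 i.2) measurableSet_Ioi, hγ_law]
    gcongr
  have h5 := measure_iUnion_le_card_mul (P.prod angleMeasure) _ h3
  have h6 := measure_iUnion_le_card_mul (P.prod angleMeasure) _ h4
  simp only [Pi.neg_apply, sub_neg_eq_add, Fintype.card_prod, Fintype.card_fin, Nat.cast_mul]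
    at h1 h2 h5 h6
  refine (measure_union_le _ _).trans (add_le_add ?_ ?_)
  · refine (measure_union_le _ _).trans ((add_le_add h1 h2).trans ?_)
    rw [two_mul]
  · refine (measure_union_le _ _).trans ((add_le_add h5 h6).trans ?_)
    rw [← mul_add, ← mul_add]

end ExceptionalSet

/-- Outside of the exceptional set, the logarithmic potential changes by at most a logarithm at
each iteration. -/
lemma abs_sum_log_last_sub_log_zero_le {Ω : Type*} {n m : ℕ} {γ : Fin m → Fin n → Ω → ℝ}
    {Z : Fin (m + 1) → Fin n → Ω → ℂ} {c : ℂ} {R ε δ T : ℝ} {ω : Ω} {θ M : ℝ}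
    (hroots : ∀ j : Fin m, Finset.univ.val.map (fun k => Z j.succ k ω) =
      (circularDerivative (fun k => γ j k ω) (fun k => Z j.castSucc k ω)).roots)
    (hpos : ∀ j k, 0 < γ j k ω) (hθ : (ω, θ) ∉ exceptionalSet γ Z c R ε δ T) (hn : 0 < n)
    (hε : 0 < ε) (hδ : 0 < δ) (hM : 1 + 2 * ‖circleMap c R θ‖ / ε ≤ M)
    (hM' : n * T * (1 + 2 * ‖circleMap c R θ‖ / ε) / δ ≤ M) :
    |∑ k, (Real.log ‖circleMap c R θ - Z (Fin.last m) k ω‖ -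
      Real.log ‖circleMap c R θ - Z 0 k ω‖)| ≤ m * Real.log M := by
  simp only [exceptionalSet, Set.mem_union, Set.mem_iUnion, Set.mem_ofPred_eq, Prod.exists, not_or,
    not_exists, not_le, not_lt] at hθ
  obtain ⟨⟨h1, h2⟩, h3, h4⟩ := hθ
  suffices h : ∀ j : Fin (m + 1), |∑ k, (Real.log ‖circleMap c R θ - Z j k ω‖ -
      Real.log ‖circleMap c R θ - Z 0 k ω‖)| ≤ (j : ℕ) * Real.log M by
    simpa using h (Fin.last m)
  intro j
  induction j using Fin.induction with
  | zero => simp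
  | succ j ih =>
    -- One weight per iteration suffices for the lower bound; index 0 is taken.
    have hstep := abs_sum_log_sub_log_le (hroots j) hε hδ ⟨0, hn⟩ (hpos j) (h4 j)
      (h1 j.castSucc) (h2 j.castSucc) (h3 j _) hM hM'
    have hsplit : ∑ k, (Real.log ‖circleMap c R θ - Z j.succ k ω‖ -
        Real.log ‖circleMap c R θ - Z 0 k ω‖) =
        ∑ k, (Real.log ‖circleMap c R θ - Z j.succ k ω‖ -
          Real.log ‖circleMap c R θ - Z j.castSucc k ω‖) +
        ∑ k, (Real.log ‖circleMap c R θ - Z j.castSucc k ω‖ -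
          Real.log ‖circleMap c R θ - Z 0 k ω‖) := by
      rw [← Finset.sum_add_distrib]
      exact Finset.sum_congr rfl fun k _ => by ring
    rw [hsplit]
    refine (abs_add_le _ _).trans ((add_le_add hstep ih).trans (le_of_eq ?_))
    simp only [Fin.val_succ, Fin.val_castSucc]
    push_cast
    ring

/-- If the measures of subsets of a product are summable, then the measures of almost all their
sections tend to zero. -/
lemma ae_tendsto_measure_section {Ω α : Type*} [MeasurableSpace Ω] [MeasurableSpace α]
    {P : Measure Ω} {ν : Measure α} [SFinite ν] {B : ℕ → Set (Ω × α)} {b : ℕ → ℝ}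
    (hb : Summable b) (hB : ∀ᶠ n in atTop, MeasurableSet (B n))
    (hBb : ∀ᶠ n in atTop, P.prod ν (B n) ≤ ENNReal.ofReal (b n)) :
    ∀ᵐ ω ∂P, Tendsto (fun n => ν (Prod.mk ω ⁻¹' B n)) atTop (𝓝 0) := by
  obtain ⟨N, hN⟩ := eventually_atTop.1 (hB.and hBb)
  -- The series of section measures has finite expectation, so it converges almost surely and its
  -- terms tend to 0.
  have h1 : ∫⁻ ω, ∑' n, ν (Prod.mk ω ⁻¹' B (n + N)) ∂P ≠ ⊤ := by
    rw [lintegral_tsum fun n =>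
      (measurable_measure_prodMk_left (hN _ (Nat.le_add_left _ _)).1).aemeasurable]
    refine ne_top_of_le_ne_top (((summable_nat_add_iff N).2 hb).tsum_ofReal_ne_top)
      (ENNReal.tsum_le_tsum fun n => ?_)
    obtain ⟨h, h'⟩ := hN (n + N) (Nat.le_add_left _ _)
    rwa [Measure.prod_apply h] at h'
  have h2 : Measurable fun ω => ∑' n, ν (Prod.mk ω ⁻¹' B (n + N)) :=
    Measurable.tsum fun n => measurable_measure_prodMk_left (hN _ (Nat.le_add_left _ _)).1
  filter_upwards [ae_lt_top h2 h1] with ω hω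
  exact (tendsto_add_atTop_iff_nat N).1 (ENNReal.tendsto_atTop_zero_of_tsum_ne_top hω.ne)

/-! ### A law of large numbers for triangular arrays -/

/-- Hoeffding's bound is geometric in `n`, so Borel–Cantelli applies whatever the joint law across
different `n`. -/
lemma ae_eventually_sum_lt {Ω : Type*} [MeasurableSpace Ω] {P : Measure Ω} [IsProbabilityMeasure P]
    {X : (n : ℕ) → Fin n → Ω → ℝ} {a b e : ℝ} (hab : a < b)
    (hX : ∀ n, 2 ≤ n → ∀ k, Measurable (X n k)) (hind : ∀ n, 2 ≤ n → iIndepFun (X n) P)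
    (hbd : ∀ n, 2 ≤ n → ∀ k ω, X n k ω ∈ Set.Icc a b)
    (he : ∀ n, 2 ≤ n → ∀ k, ∫ ω, X n k ω ∂P = e) {t : ℝ} (ht : 0 < t) :
    ∀ᵐ ω ∂P, ∀ᶠ n : ℕ in atTop, ∑ k, (X n k ω - e) < t * n := by
  -- The sub-Gaussian parameter from Hoeffding's lemma.
  set q := (‖b - a‖₊ / 2) ^ 2 with hq
  have hq0 : (0 : ℝ) < q := by
    rw [hq]
    have : 0 < ‖b - a‖ := norm_pos_iff.2 (sub_pos.2 hab).ne'
    push_cast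
    positivity
  have hbound : ∀ n : ℕ, 2 ≤ n → P {ω | t * n ≤ ∑ k, (X n k ω - e)} ≤
      ENNReal.ofReal (Real.exp (-t ^ 2 / (2 * q)) ^ n) := by
    intro n hn
    have hn0 : (0 : ℝ) < n := by exact_mod_cast (by omega : 0 < n)
    have h1 := HasSubgaussianMGF.measure_sum_ge_le_of_iIndepFun (μ := P)
      (X := fun k ω => X n k ω - e) (c := fun _ => q) (s := Finset.univ)
      ((hind n hn).comp (fun _ y => y - e) fun _ => by fun_prop) (fun k _ => by
        have := hasSubgaussianMGF_of_mem_Icc (μ := P) (hX n hn k).aemeasurable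
          (ae_of_all _ (hbd n hn k))
        rwa [he n hn k] at this) (ε := t * n) (by positivity)
    rw [← ofReal_measureReal]
    refine ENNReal.ofReal_le_ofReal (h1.trans (le_of_eq ?_))
    rw [← Real.exp_nat_mul]
    congr 1
    simp only [Finset.sum_const, Finset.card_univ, Fintype.card_fin, nsmul_eq_mul]
    push_cast
    field_simp
  have hsum : Summable fun n : ℕ => Real.exp (-t ^ 2 / (2 * q)) ^ n :=
    summable_geometric_of_lt_one (Real.exp_nonneg _) (by
      rw [Real.exp_lt_one_iff, neg_div]; exact neg_neg_of_pos (by positivity))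
  have h2 := ae_eventually_notMem (μ := P)
    (s := fun n : ℕ => {ω | t * (n + 2 : ℕ) ≤ ∑ k, (X (n + 2) k ω - e)})
    (ne_top_of_le_ne_top ((summable_nat_add_iff 2).2 hsum).tsum_ofReal_ne_top
      (ENNReal.tsum_le_tsum fun n => hbound (n + 2) (by omega)))
  filter_upwards [h2] with ω hω
  obtain ⟨N, hN⟩ := eventually_atTop.1 hω
  filter_upwards [eventually_ge_atTop (N + 2)] with n hn
  obtain ⟨i, rfl⟩ := Nat.exists_eq_add_of_le' (show 2 ≤ n by omega)
  simpa using hN i (by omega)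

/-- The strong law of large numbers for triangular arrays of bounded variables. -/
lemma ae_tendsto_average {Ω : Type*} [MeasurableSpace Ω] {P : Measure Ω} [IsProbabilityMeasure P]
    {X : (n : ℕ) → Fin n → Ω → ℝ} {a b e : ℝ} (hab : a < b)
    (hX : ∀ n, 2 ≤ n → ∀ k, Measurable (X n k)) (hind : ∀ n, 2 ≤ n → iIndepFun (X n) P)
    (hbd : ∀ n, 2 ≤ n → ∀ k ω, X n k ω ∈ Set.Icc a b)
    (he : ∀ n, 2 ≤ n → ∀ k, ∫ ω, X n k ω ∂P = e) :
    ∀ᵐ ω ∂P, Tendsto (fun n : ℕ => (n : ℝ)⁻¹ * ∑ k, X n k ω) atTop (𝓝 e) := by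
  have h1 : ∀ᵐ ω ∂P, ∀ i : ℕ, ∀ᶠ n : ℕ in atTop, ∑ k, (X n k ω - e) < (1 / (i + 1) : ℝ) * n :=
    ae_all_iff.2 fun i => ae_eventually_sum_lt hab hX hind hbd he (by positivity)
  have h2 : ∀ᵐ ω ∂P, ∀ i : ℕ, ∀ᶠ n : ℕ in atTop,
      ∑ k, (-X n k ω - -e) < (1 / (i + 1) : ℝ) * n :=
    ae_all_iff.2 fun i => ae_eventually_sum_lt (X := fun n k ω => -X n k ω)
      (show -b < -a by linarith) (fun n hn k => (hX n hn k).neg)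
      (fun n hn => (hind n hn).comp (fun _ y => -y) fun _ => measurable_neg)
      (fun n hn k ω => ⟨neg_le_neg (hbd n hn k ω).2, neg_le_neg (hbd n hn k ω).1⟩)
      (fun n hn k => by rw [integral_neg, he n hn k]) (by positivity)
  filter_upwards [h1, h2] with ω hω1 hω2
  rw [Metric.tendsto_nhds]
  intro t ht
  obtain ⟨i, hi⟩ := exists_nat_one_div_lt ht
  filter_upwards [hω1 i, hω2 i, eventually_gt_atTop 0] with n hn1 hn2 hn
  have hn0 : (0 : ℝ) < n := by exact_mod_cast hn
  have e1 : ∑ k, (X n k ω - e) = ∑ k, X n k ω - n * e := by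
    rw [Finset.sum_sub_distrib]; simp
  have e2 : ∑ k, (-X n k ω - -e) = n * e - ∑ k, X n k ω := by
    rw [Finset.sum_sub_distrib, Finset.sum_neg_distrib]; simp; ring
  rw [e1] at hn1
  rw [e2] at hn2
  have e3 : (n : ℝ)⁻¹ * ∑ k, X n k ω - e = (n : ℝ)⁻¹ * (∑ k, X n k ω - n * e) := by
    field_simp
  rw [Real.dist_eq, e3, abs_mul, abs_of_pos (inv_pos.2 hn0), inv_mul_lt_iff₀ hn0, abs_lt]
  have := mul_lt_mul_of_pos_right hi hn0
  constructor <;> linarith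

/-! ### The iteration does not change the limit of the averages of `circleLog` -/

lemma inv_pow_rpow_le {x s : ℝ} {D : ℕ} (hx : 1 ≤ x) (hD : 4 ≤ D * s) :
    ((x ^ D)⁻¹) ^ s ≤ (x ^ 4)⁻¹ := by
  have hx0 : 0 < x := by linarith
  rw [Real.inv_rpow (by positivity), ← Real.rpow_natCast, ← Real.rpow_mul hx0.le]
  refine inv_anti₀ (by positivity) ?_
  calc x ^ 4 = x ^ (4 : ℝ) := by norm_cast
    _ ≤ _ := Real.rpow_le_rpow_of_exponent_le hx hD

lemma ae_tendsto_average_circleLog_sub {Ω : Type*} [MeasurableSpace Ω] (P : Measure Ω)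
    [IsProbabilityMeasure P] {a : ℝ} (ha : 0 < a)
    {m : ℕ → ℕ} (hm : ∀ n, 2 ≤ n → 1 ≤ m n ∧ m n ≤ n - 1)
    (hmlim : Tendsto (fun n : ℕ => (m n : ℝ) / ((n : ℝ) / Real.log n)) atTop (𝓝 0))
    {Z : (n : ℕ) → Fin (m n + 1) → Fin n → Ω → ℂ}
    {γ : (n : ℕ) → Fin (m n) → Fin n → Ω → ℝ}
    (hZ_meas : ∀ n, 2 ≤ n → ∀ k, Measurable (Z n 0 k))
    (hγ_meas : ∀ n, 2 ≤ n → ∀ j k, Measurable (γ n j k))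
    (hγ_law : ∀ n, 2 ≤ n → ∀ j k, P.map (γ n j k) = gammaMeasure a 1)
    (hγ_indep : ∀ n, 2 ≤ n → iIndepFun (fun p : Fin (m n) × Fin n => γ n p.1 p.2) P)
    (hZγ : ∀ n, 2 ≤ n → IndepFun (fun ω k => Z n 0 k ω)
      (fun ω (p : Fin (m n) × Fin n) => γ n p.1 p.2 ω) P)
    (hiter : ∀ n, 2 ≤ n → IsCircularIteration P (γ n) (Z n)) (c : ℂ) {R : ℝ} (hR : 0 < R) :
    ∀ᵐ ω ∂P, Tendsto (fun n : ℕ => (n : ℝ)⁻¹ * ∑ k, (circleLog c R (Z n (Fin.last (m n)) k ω) -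
      circleLog c R (Z n 0 k ω))) atTop (𝓝 0) := by
  obtain ⟨C₁, hC₁, hball⟩ := exists_gammaMeasure_Icc_le ha
  obtain ⟨C₂, hC₂, htail⟩ := exists_gammaMeasure_Ioi_le ha
  -- With `δ = n ^ (-D)`, these conditions make both `δ ^ (1/2)` and `δ ^ (a/2)` at most `n ^ (-4)`.
  obtain ⟨D, hD8, hDa⟩ : ∃ D : ℕ, 8 ≤ D ∧ 8 ≤ D * a := by
    refine ⟨max 8 ⌈8 / a⌉₊, le_max_left _ _, ?_⟩
    have h1 : 8 / a ≤ (max 8 ⌈8 / a⌉₊ : ℕ) :=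
      (Nat.le_ceil _).trans (by exact_mod_cast le_max_right _ _)
    rwa [div_le_iff₀ ha] at h1
  have hZ : ∀ n, 2 ≤ n → ∀ j k, Measurable (Z n j k) := fun n hn j k =>
    ((hiter n hn).labelling j k).mono (circularPast_le (hZ_meas n hn) (hγ_meas n hn) _) le_rfl
  set B : ℕ → Set (Ω × ℝ) := fun n => exceptionalSet (γ n) (Z n) c R ((n : ℝ) ^ 8)⁻¹
    ((n : ℝ) ^ D)⁻¹ ((n : ℝ) ^ 4) with hB
  have hB_meas : ∀ n, 2 ≤ n → MeasurableSet (B n) := fun n hn =>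
    measurableSet_exceptionalSet (hZ n hn) (hγ_meas n hn)
  set K : ℝ := 2 * (sinConst * (R⁻¹) ^ (1 / 2 : ℝ)) + 2 * Real.pi * (2 * C₁ + C₂) with hK
  -- At most `n²` events of each kind, each of measure `O(n ^ (-4))`.
  have hB_le : ∀ n, 2 ≤ n → P.prod angleMeasure (B n) ≤ ENNReal.ofReal (K * ((n : ℝ) ^ 2)⁻¹) := by
    intro n hn
    have hn1 : (1 : ℝ) ≤ n := by exact_mod_cast (by omega : 1 ≤ n)
    have hn0 : (0 : ℝ) < n := by linarith
    have hs := sinConst_nonneg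
    have hp : ∀ x, gammaMeasure a 1 (Set.Icc (x - ((n : ℝ) ^ D)⁻¹) (x + ((n : ℝ) ^ D)⁻¹)) ≤
        ENNReal.ofReal (2 * C₁ * ((n : ℝ) ^ 4)⁻¹) := by
      intro x
      refine (hball _ (by positivity) x).trans (ENNReal.ofReal_le_ofReal ?_)
      have h1 : (((n : ℝ) ^ D)⁻¹) ^ (a / 2) ≤ ((n : ℝ) ^ 4)⁻¹ :=
        inv_pow_rpow_le hn1 (by linarith)
      have h2 : (((n : ℝ) ^ D)⁻¹) ^ (1 / 2 : ℝ) ≤ ((n : ℝ) ^ 4)⁻¹ :=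
        inv_pow_rpow_le hn1 (by
          have : (8 : ℝ) ≤ D := by exact_mod_cast hD8
          linarith)
      calc C₁ * ((((n : ℝ) ^ D)⁻¹) ^ (a / 2) + (((n : ℝ) ^ D)⁻¹) ^ (1 / 2 : ℝ))
          ≤ C₁ * (((n : ℝ) ^ 4)⁻¹ + ((n : ℝ) ^ 4)⁻¹) := by gcongr
        _ = _ := by ring
    refine (prod_exceptionalSet_le (hZ n hn) (hγ_meas n hn) (hγ_law n hn) (hγ_indep n hn)
      (hZγ n hn) (hiter n hn).labelling hR (by positivity) hp (htail _ (by positivity))).trans ?_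
    have hmn : m n + 1 ≤ n := by have := hm n hn; omega
    have hsqrt : (((n : ℝ) ^ 8)⁻¹ / R) ^ (1 / 2 : ℝ) ≤ ((n : ℝ) ^ 4)⁻¹ * (R⁻¹) ^ (1 / 2 : ℝ) := by
      rw [div_eq_mul_inv, Real.mul_rpow (by positivity) (by positivity)]
      gcongr
      exact inv_pow_rpow_le hn1 (by norm_num)
    calc _ ≤ 2 * ((n : ENNReal) * n * ENNReal.ofReal (sinConst *
          (((n : ℝ) ^ 4)⁻¹ * (R⁻¹) ^ (1 / 2 : ℝ)))) + n * n * (ENNReal.ofReal (2 * Real.pi) *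
          (ENNReal.ofReal (2 * C₁ * ((n : ℝ) ^ 4)⁻¹) + ENNReal.ofReal (C₂ / (n : ℝ) ^ 4))) := by
          gcongr
          omega
      _ = ENNReal.ofReal (2 * ((n : ℝ) * n * (sinConst *
          (((n : ℝ) ^ 4)⁻¹ * (R⁻¹) ^ (1 / 2 : ℝ)))) + n * n * (2 * Real.pi *
          (2 * C₁ * ((n : ℝ) ^ 4)⁻¹ + C₂ / (n : ℝ) ^ 4))) := by
          rw [← ENNReal.ofReal_natCast n, ← ENNReal.ofReal_add (by positivity) (by positivity),
            ← ENNReal.ofReal_mul (by positivity), ← ENNReal.ofReal_mul (by positivity),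
            ← ENNReal.ofReal_mul (by positivity), ← ENNReal.ofReal_mul (by positivity),
            show (2 : ENNReal) = ENNReal.ofReal 2 by simp,
            ← ENNReal.ofReal_mul (by positivity), ← ENNReal.ofReal_add (by positivity)
            (by positivity)]
      _ = _ := by
          congr 1
          rw [hK]
          field_simp
  have hsum : Summable fun n : ℕ => K * ((n : ℝ) ^ 2)⁻¹ :=
    (Real.summable_nat_pow_inv.2 one_lt_two).mul_left K
  have hsec := ae_tendsto_measure_section (P := P) (ν := angleMeasure) (B := B) hsum
    (eventually_atTop.2 ⟨2, hB_meas⟩) (eventually_atTop.2 ⟨2, hB_le⟩)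
  have hroots : ∀ᵐ ω ∂P, ∀ n, 2 ≤ n → ∀ j : Fin (m n),
      Finset.univ.val.map (fun k => Z n j.succ k ω) =
        (circularDerivative (fun k => γ n j k ω) (fun k => Z n j.castSucc k ω)).roots :=
    ae_all_iff.2 fun n => Filter.eventually_imp_distrib_left.2 fun hn =>
      ae_all_iff.2 fun j => (hiter n hn).zeros j
  have hpos : ∀ᵐ ω ∂P, ∀ n, 2 ≤ n → ∀ (j : Fin (m n)) (k : Fin n), 0 < γ n j k ω := by
    refine ae_all_iff.2 fun n => Filter.eventually_imp_distrib_left.2 fun hn =>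
      ae_all_iff.2 fun j => ae_all_iff.2 fun k => ?_
    have h := ae_gammaMeasure_pos a 1
    rw [← hγ_law n hn j k] at h
    exact ae_of_ae_map (hγ_meas n hn j k).aemeasurable h
  filter_upwards [hsec, hroots, hpos] with ω h1 h2 h3
  -- The exponent `14 + D` comes from `n * T * A / δ ≤ n * n ^ 4 * n ^ 9 * n ^ D`, where `A ≤ n ^ 9`
  -- once `n ≥ 1 + 2 (‖c‖ + R)`.
  refine tendsto_average_circleLog_sub c hR (B := fun n => Prod.mk ω ⁻¹' B n)
    (ε := fun n => ((14 + D : ℕ) : ℝ) * ((m n : ℝ) / ((n : ℝ) / Real.log n)))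
    (eventually_atTop.2 ⟨2, fun n hn => measurable_prodMk_left (hB_meas n hn)⟩) h1
    (by simpa using hmlim.const_mul ((14 + D : ℕ) : ℝ)) ?_
  filter_upwards [eventually_ge_atTop 2, eventually_ge_atTop ⌈1 + 2 * (‖c‖ + R)⌉₊] with n hn hnc θ hθ
  have hn1 : (1 : ℝ) ≤ n := by exact_mod_cast (by omega : 1 ≤ n)
  have hn0 : (0 : ℝ) < n := by linarith
  have hx : ‖circleMap c R θ‖ ≤ ‖c‖ + R := by
    refine (norm_add_le _ _).trans ?_
    simp [abs_of_pos hR]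
  have hnx : 1 + 2 * ‖circleMap c R θ‖ ≤ n := by
    have := (Nat.le_ceil _).trans (Nat.cast_le (α := ℝ).2 hnc)
    linarith
  have h9 : 1 + 2 * ‖circleMap c R θ‖ / ((n : ℝ) ^ 8)⁻¹ ≤ (n : ℝ) ^ 9 := by
    rw [div_inv_eq_mul]
    have h8 : (1 : ℝ) ≤ (n : ℝ) ^ 8 := one_le_pow₀ hn1
    calc 1 + 2 * ‖circleMap c R θ‖ * (n : ℝ) ^ 8 ≤ (1 + 2 * ‖circleMap c R θ‖) * (n : ℝ) ^ 8 := by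
          linarith
      _ ≤ n * (n : ℝ) ^ 8 := by gcongr
      _ = _ := by ring
  have hbound := abs_sum_log_last_sub_log_zero_le (M := (n : ℝ) ^ (14 + D)) (h2 n hn) (h3 n hn) hθ
    (by omega) (by positivity) (by positivity)
    (h9.trans (pow_le_pow_right₀ hn1 (by omega))) (by
      rw [div_inv_eq_mul]
      calc n * (n : ℝ) ^ 4 * (1 + 2 * ‖circleMap c R θ‖ / ((n : ℝ) ^ 8)⁻¹) * (n : ℝ) ^ D
          ≤ n * (n : ℝ) ^ 4 * (n : ℝ) ^ 9 * (n : ℝ) ^ D := by gcongr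
        _ = _ := by ring)
  rw [abs_mul, abs_of_pos (inv_pos.2 hn0)]
  refine (mul_le_mul_of_nonneg_left hbound (by positivity)).trans (le_of_eq ?_)
  rw [Real.log_pow]
  have hlog : Real.log n ≠ 0 := (Real.log_pos (by exact_mod_cast (by omega : 1 < n))).ne'
  field_simp

/-! ### Empirical measures -/

lemma toMeasure_empiricalMeasure {n : ℕ} (z : Fin n → ℂ) :
    (empiricalMeasure z : Measure ℂ) = (n : ℝ≥0)⁻¹ • ∑ k, Measure.dirac (z k) := by
  rw [empiricalMeasure, FiniteMeasure.toMeasure_smul, FiniteMeasure.toMeasure_sum]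
  rfl

lemma isProbabilityMeasure_empiricalMeasure {n : ℕ} (hn : n ≠ 0) (z : Fin n → ℂ) :
    IsProbabilityMeasure (empiricalMeasure z : Measure ℂ) := by
  constructor
  rw [toMeasure_empiricalMeasure]
  simp only [Measure.smul_apply, Measure.finsetSum_apply, measure_univ, Finset.sum_const,
    Finset.card_univ, Fintype.card_fin, nsmul_eq_mul, mul_one, ENNReal.smul_def, smul_eq_mul]
  rw [ENNReal.coe_inv (by exact_mod_cast hn), ENNReal.coe_natCast,
    ENNReal.inv_mul_cancel (by exact_mod_cast hn) (ENNReal.natCast_ne_top n)]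

lemma integral_empiricalMeasure {n : ℕ} (z : Fin n → ℂ) (f : ℂ → ℝ) :
    ∫ w, f w ∂(empiricalMeasure z : Measure ℂ) = (n : ℝ)⁻¹ * ∑ k, f (z k) := by
  rw [toMeasure_empiricalMeasure, integral_smul_nnreal_measure, integral_finsetSum_measure]
  · simp [NNReal.smul_def]
  · intro k _
    exact integrable_dirac (by simp)

/-! ### The main theorem. -/

theorem theorem6 {Ω : Type*} [MeasurableSpace Ω] (P : Measure Ω) [IsProbabilityMeasure P]
    (β : ℝ) (hβ : 0 < β)
    (μ : ProbabilityMeasure ℂ)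
    (hμ : ∃ c : ℝ, 0 < c ∧ ∃ C : ℝ, ∀ R : ℝ, 1 ≤ R →
      R ^ c * (μ : Measure ℂ).real {z : ℂ | R < ‖z‖} ≤ C)
    (m : ℕ → ℕ) (hm : ∀ n, 2 ≤ n → 1 ≤ m n ∧ m n ≤ n - 1)
    (hmlim : Tendsto (fun n : ℕ => (m n : ℝ) / ((n : ℝ) / Real.log n)) atTop (𝓝 0))
    (Z : (n : ℕ) → Fin (m n + 1) → Fin n → Ω → ℂ)
    (γ : (n : ℕ) → Fin (m n) → Fin n → Ω → ℝ)
    -- for each `n`, the initial points are i.i.d. with law `μ`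
    (hZ_meas : ∀ n, 2 ≤ n → ∀ k, Measurable (Z n 0 k))
    (hZ_law : ∀ n, 2 ≤ n → ∀ k, P.map (Z n 0 k) = (μ : Measure ℂ))
    (hZ_indep : ∀ n, 2 ≤ n → iIndepFun (Z n 0) P)
    -- for each `n`, the weights are i.i.d. with the Gamma law of parameter `β / 2`
    (hγ_meas : ∀ n, 2 ≤ n → ∀ j k, Measurable (γ n j k))
    (hγ_law : ∀ n, 2 ≤ n → ∀ j k, P.map (γ n j k) = gammaMeasure (β / 2) 1)
    (hγ_indep : ∀ n, 2 ≤ n → iIndepFun (fun p : Fin (m n) × Fin n => γ n p.1 p.2) P)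
    -- for each `n`, the weights are independent of the initial points
    (hZγ : ∀ n, 2 ≤ n → IndepFun (fun ω k => Z n 0 k ω)
      (fun ω (p : Fin (m n) × Fin n) => γ n p.1 p.2 ω) P)
    (hiter : ∀ n, 2 ≤ n → IsCircularIteration P (γ n) (Z n)) :
    ∀ᵐ ω ∂P, Tendsto (fun n : ℕ => empiricalMeasure (fun k => Z n (Fin.last (m n)) k ω)) atTop
      (𝓝 μ.toFiniteMeasure) := by
  -- There are only countably many bumps, so one null set serves them all.
  have hbump : ∀ᵐ ω ∂P, ∀ (i : ℕ) (r R : ℚ), 0 < r → r < R →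
      Tendsto (fun n : ℕ => (n : ℝ)⁻¹ * ∑ k, logBump (TopologicalSpace.denseSeq ℂ i) r R
        (Z n (Fin.last (m n)) k ω)) atTop
        (𝓝 (∫ w, logBump (TopologicalSpace.denseSeq ℂ i) r R w ∂(μ : Measure ℂ))) := by
    refine ae_all_iff.2 fun i => ae_all_iff.2 fun r => ae_all_iff.2 fun R =>
      Filter.eventually_imp_distrib_left.2 fun hr => Filter.eventually_imp_distrib_left.2 fun hrR => ?_
    have hr' : (0 : ℝ) < r := by exact_mod_cast hr
    have hrR' : (r : ℝ) < R := by exact_mod_cast hrR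
    set c := TopologicalSpace.denseSeq ℂ i
    have hcont := continuous_logBump c r R
    have h0 := ae_tendsto_average (P := P) (X := fun n k ω => logBump c r R (Z n 0 k ω))
      (a := 0) (b := Real.log R - Real.log r) (e := ∫ w, logBump c r R w ∂(μ : Measure ℂ))
      (sub_pos.2 (Real.log_lt_log hr' hrR'))
      (fun n hn k => hcont.measurable.comp (hZ_meas n hn k))
      (fun n hn => (hZ_indep n hn).comp (fun _ => logBump c r R) fun _ => hcont.measurable)
      (fun n hn k ω => logBump_mem_Icc hr' hrR' _)
      (fun n hn k => by
        rw [← hZ_law n hn k, integral_map (hZ_meas n hn k).aemeasurable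
          hcont.measurable.aestronglyMeasurable])
    have hβ2 : 0 < β / 2 := by positivity
    filter_upwards [h0,
      ae_tendsto_average_circleLog_sub P hβ2 hm hmlim hZ_meas hγ_meas hγ_law hγ_indep hZγ hiter c hr',
      ae_tendsto_average_circleLog_sub P hβ2 hm hmlim hZ_meas hγ_meas hγ_law hγ_indep hZγ hiter c
        (hr'.trans hrR')] with ω h1 h2 h3
    have h4 := (h3.sub h2).add h1
    rw [sub_zero, zero_add] at h4
    refine h4.congr fun n => ?_
    rw [← mul_sub, ← mul_add, ← Finset.sum_sub_distrib, ← Finset.sum_add_distrib]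
    congr 1
    refine Finset.sum_congr rfl fun k _ => ?_
    simp only [logBump]
    ring
  filter_upwards [hbump] with ω hω
  -- The index 0 is skipped because its empirical measure is not a probability measure.
  rw [← tendsto_add_atTop_iff_nat 1]
  have := tendsto_of_tendsto_integral_logBump (μ := μ)
    (ν := fun n => ⟨(empiricalMeasure (fun k => Z (n + 1) (Fin.last (m (n + 1))) k ω) : Measure ℂ),
      isProbabilityMeasure_empiricalMeasure n.succ_ne_zero _⟩) (fun i r R hr hrR => by
      refine ((tendsto_add_atTop_iff_nat 1).2 (hω i r R hr hrR)).congr fun n => ?_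
      exact (integral_empiricalMeasure _ _).symm)
  exact (ProbabilityMeasure.tendsto_nhds_iff_toFiniteMeasure_tendsto_nhds _).1 this
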